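/- Work over $\mathbb{C}$. Let $N\cong\mathbb{Z}^r$ be a lattice, $M=\mathrm{Hom}(N,\mathbb{Z})$, $T=\mathbb{G}_m\otimes N$ the torus with character lattice $M$, and let $\tau\subset N_{\mathbb{R}}$ be an $r$-dimensional rational polyhedral cone, with affine toric variety $U_\tau=\mathrm{Spec}\,\mathbb{C}[\tau^\vee\cap M]$ and zero-dimensional stratum $p_\tau\in U_\tau$. Let $Y$ be an affine variety with an algebraic $T$-action, and let $0\neq\xi\in N_{\mathbb{R}}$ lie in the interior of $\tau$. (For a non-zero $\xi\in\tau$ contained in no proper rational subspace of $N_{\mathbb{R}}$ this is automatic.) An algebraic negative weight deformation of $(Y,\xi)$ over $U_\tau$ is a faithfully flat $T$-equivariant affine morphism $p:\mathcal{Y}\to U_\tau$ from a variety $\mathcal{Y}$ with $T$-action, together with a $T$-equivariant isomorphism $p^{-1}(p_\tau)\cong Y$ (scheme-theoretic fibre), such that $\xi\in\tau$ and the $T$-action on $Y$ is good, i.e. effective with a $T$-fixed closed point that lies in the closure of every $T$-orbit. An affine variety $V$ is a deformation of negative $\xi$-weight of $Y$ (Conlon–Hein, Definition 1.7) if there are $\xi_i\in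 N_{\mathbb{R}}$ (regarded as elements of the Lie algebra of $T$) and real numbers $c_i>0$ $(i\in\mathbb{N})$ with $\xi_i\to\xi$ such that for all $i$: 1. $c_i\xi_i$ generates an effective algebraic $\mathbb{C}^*$-action on $Y$ (so $c_i\xi_i\in N$); 2. there is a triple $(W_i,p_i,\sigma_i)$, where $W_i$ is an affine variety, $p_i:W_i\to\mathbb{C}$ a regular function with $p_i^{-1}(0)\cong Y$ and $p_i^{-1}(s)\cong V$ for all $s\neq0$, and $\sigma_i$ an effective algebraic $\mathbb{C}^*$-action on $W_i$ such that $p_i(\sigma_i(z,x))=z^{\mu_i}p_i(x)$ for a positive integer $\mu_i$ and $\sigma_i$ restricts on $p_i^{-1}(0)\cong Y$ to the action generated by $c_i\xi_i$; 3. the numbers $\lambda_i=-k_i\mu_i/c_i$ satisfy $\lambda_i\le-\delta$ for some $\delta>0$ independent of $i$, where $k_i\in\mathbb{N}\cup\{\infty\}$ is the vanishing order of the deformation $p_i$, the supremum of all $k\geq 1$ for which its base change to $\mathrm{Spec}\,\mathbb{C}[s]/(s^k)$ is isomorphic to the trivial deformation of $Y$ by an isomorphism that is the identity on the central fibre. **Lemma.**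 If $p:\mathcal{Y}\to U_\tau$ is an algebraic negative weight deformation of $(Y,\xi)$, then its general fibre, i.e. the scheme-theoretic fibre $p^{-1}(u)$ over any closed point $u$ of the open $T$-orbit of $U_\tau$, is a deformation of negative $\xi$-weight of $Y$. -/

import Mathlib

open Filter Topology
open scoped ENNReal Polynomial

universe u

noncomputable section

namespace NegativeWeight

/-! ## Algebraic tori and their actions on affine schemes

All schemes are affine over `ℂ` and are given by their coordinate rings. A split torus with
character lattice `M` is `T = Spec ℂ[M]`; its group of closed points is `Hom(M, ℂˣ)`. -/

/-- An algebraic action of the torus `T = Spec ℂ[M]` on the affine scheme `Spec R`: the comorphism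
`R → R ⊗ ℂ[M] = R[M]`, `f ↦ ∑ f_m χ^m` of the action morphism `T × Spec R → Spec R`, so that
`f (t • x) = ∑ f_m (x) χ^m (t)`. The two axioms say that the unit of `T` acts trivially and that
the action is associative. -/
structure TorusAction (M : Type*) [AddCommGroup M] (R : Type*) [CommRing R] [Algebra ℂ R] where
  coact : R →ₐ[ℂ] AddMonoidAlgebra R M
  counit : ∀ f : R, ((coact f).coeff.sum fun _ a => a) = f
  coassoc : ∀ (f : R) (m : M),
    coact ((coact f).coeff m) = AddMonoidAlgebra.single m ((coact f).coeff m)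

namespace TorusAction

variable {M L : Type*} [AddCommGroup M] [AddCommGroup L]
variable {R S : Type*} [CommRing R] [Algebra ℂ R] [CommRing S] [Algebra ℂ S]

/-- The function `x ↦ f (t • x)` for a closed point `t` of the torus. -/
def translate (a : TorusAction M R) (t : Multiplicative M →* ℂˣ) (f : R) : R :=
  (a.coact f).coeff.sum fun m g => ((t (Multiplicative.ofAdd m) : ℂˣ) : ℂ) • g

/-- The action is effective: only the unit of the torus acts trivially. -/
def IsEffective (a : TorusAction M R) : Prop :=
  ∀ t : Multiplicative M →* ℂˣ, (∀ f, a.translate t f = f) → t = 1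

/-- The function `f` is a semi-invariant of weight `m`: `f (t • x) = χ^m (t) f (x)`. -/
def HasWeight (a : TorusAction M R) (m : M) (f : R) : Prop :=
  a.coact f = AddMonoidAlgebra.single m f

/-- The morphism `Spec S → Spec R` with comorphism `φ` is equivariant. -/
def IsEquivariant (a : TorusAction M R) (b : TorusAction M S) (φ : R →ₐ[ℂ] S) : Prop :=
  ∀ f, b.coact (φ f) = AddMonoidAlgebra.mapAlgHom M φ (a.coact f)

/-- Good torus action: it is effective and there is a closed point `v`, fixed by the torus, that
lies in the Zariski closure of every orbit (closed points are `ℂ`-algebra maps to `ℂ`). -/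
def IsGood (a : TorusAction M R) : Prop :=
  a.IsEffective ∧
    ∃ v : R →ₐ[ℂ] ℂ, (∀ t f, v (a.translate t f) = v f) ∧
      ∀ (x : R →ₐ[ℂ] ℂ) (f : R), (∀ t, x (a.translate t f) = 0) → v f = 0

/-- Restriction of an action along the homomorphism `Spec ℂ[L] → Spec ℂ[M]` of tori that is dual
to `φ : M → L`. For `L = ℤ` this restricts the action to a one-parameter subgroup. -/
def restrict (a : TorusAction M R) (φ : M →+ L) : TorusAction L R where
  coact := (AddMonoidAlgebra.mapDomainAlgHom ℂ R φ).comp a.coact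
  counit f := by
    have h : ((AddMonoidAlgebra.mapDomainAlgHom ℂ R φ) (a.coact f)).coeff =
        Finsupp.mapDomain φ (a.coact f).coeff := rfl
    rw [AlgHom.comp_apply, h, Finsupp.sum_mapDomain_index (fun _ => rfl) (fun _ _ _ => rfl)]
    exact a.counit f
  coassoc f l := by
    classical
    have h : ((AddMonoidAlgebra.mapDomainAlgHom ℂ R φ) (a.coact f)).coeff l =
        ∑ m ∈ (a.coact f).coeff.support with φ m = l, (a.coact f).coeff m := by
      change Finsupp.mapDomain φ (a.coact f).coeff l = _
      rw [Finsupp.mapDomain, Finsupp.sum, Finsupp.finsetSum_apply, Finset.sum_filter]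
      exact Finset.sum_congr rfl fun m _ => Finsupp.single_apply
    simp only [AlgHom.comp_apply]
    rw [h, map_sum, map_sum, ← AddMonoidAlgebra.singleAddHom_apply, map_sum]
    refine Finset.sum_congr rfl fun m hm => ?_
    rw [a.coassoc, ← (Finset.mem_filter.mp hm).2]
    simp

end TorusAction

/-! ## Affine toric varieties -/

section Toric

variable {r : ℕ}

/-- The pairing of `m ∈ M = ℤ^r` with `x ∈ N_ℝ = ℝ^r`. -/
def realPairing (m : Fin r → ℤ) (x : Fin r → ℝ) : ℝ := ∑ j, (m j : ℝ) * x j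

/-- The pairing `M → ℤ` with an element `l` of `N = ℤ^r`. -/
def pairing (l : Fin r → ℤ) : (Fin r → ℤ) →+ ℤ where
  toFun m := ∑ j, m j * l j
  map_zero' := by simp
  map_add' m n := by simp [add_mul, Finset.sum_add_distrib]

/-- The convex cone `τ ⊆ N_ℝ` is generated by finitely many elements of the lattice `N = ℤ^r`. -/
def IsRationalPolyhedral (τ : PointedCone ℝ (Fin r → ℝ)) : Prop :=
  ∃ S : Finset (Fin r → ℤ),
    τ = PointedCone.hull ℝ ((fun (l : Fin r → ℤ) (j : Fin r) => (l j : ℝ)) '' (S : Set (Fin r → ℤ)))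

/-- The monoid `S_τ = τ^∨ ∩ M`. -/
def dualMonoid (τ : PointedCone ℝ (Fin r → ℝ)) : AddSubmonoid (Fin r → ℤ) where
  carrier := {m | ∀ x ∈ τ, 0 ≤ realPairing m x}
  zero_mem' := by intro x _; simp [realPairing]
  add_mem' {m n} hm hn := by
    intro x hx
    have h := add_nonneg (hm x hx) (hn x hx)
    simpa [realPairing, add_mul, Finset.sum_add_distrib] using h

/-- The coordinate ring `ℂ[S_τ]` of the affine toric variety `U_τ`. -/
abbrev ToricRing (τ : PointedCone ℝ (Fin r → ℝ)) : Type := AddMonoidAlgebra ℂ (dualMonoid τ)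

/-- The character `χ^m`, `m ∈ S_τ`, as a function on `U_τ`. -/
def chi {τ : PointedCone ℝ (Fin r → ℝ)} (m : dualMonoid τ) : ToricRing τ :=
  AddMonoidAlgebra.single m 1

/-- The ideal of the zero-dimensional stratum `p_τ` of `U_τ` (for a full-dimensional `τ`): all
the characters `χ^m` with `m ∈ S_τ` non-zero vanish there. -/
def vertexIdeal (τ : PointedCone ℝ (Fin r → ℝ)) : Ideal (ToricRing τ) :=
  Ideal.span {f | ∃ m : dualMonoid τ, m ≠ 0 ∧ f = chi m}

/-- The ideal of the closed point of `U_τ` that is the image of `t ∈ T(ℂ)`, where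
`χ^m` takes the value `χ^m (t)`. These are the points of the open orbit. -/
def torusPointIdeal (τ : PointedCone ℝ (Fin r → ℝ)) (t : Multiplicative (Fin r → ℤ) →* ℂˣ) :
    Ideal (ToricRing τ) :=
  Ideal.span {f | ∃ m : dualMonoid τ,
    f = chi m - algebraMap ℂ _ ((t (Multiplicative.ofAdd (m : Fin r → ℤ)) : ℂˣ) : ℂ)}

end Toric

/-! ## Algebraic negative weight deformations -/

/-- A generalized (unpolarized affine) test configuration `p : 𝒴 = Spec R → U_τ`, with
`N = M = ℤ^r` and `T = 𝔾_m ⊗ N`: the cone `τ` is rational polyhedral of dimension `r`, `𝒴` is a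
variety with a `T`-action, and `p` is faithfully flat and `T`-equivariant (on `U_τ` the function
`χ^m` has weight `m`). -/
structure GeneralizedTestConfiguration {r : ℕ} (τ : PointedCone ℝ (Fin r → ℝ))
    (R : Type u) [CommRing R] [Algebra ℂ R] where
  isRationalPolyhedral : IsRationalPolyhedral τ
  fullDimensional : Submodule.span ℝ (τ : Set (Fin r → ℝ)) = ⊤
  isDomain : IsDomain R
  finiteType : Algebra.FiniteType ℂ R
  action : TorusAction (Fin r → ℤ) R
  /-- The comorphism of `p`. -/
  proj : ToricRing τ →ₐ[ℂ] R
  faithfullyFlat : proj.toRingHom.FaithfullyFlat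
  equivariant : ∀ m : dualMonoid τ, action.HasWeight (m : Fin r → ℤ) (proj (chi m))

/-- The coordinate ring of the scheme-theoretic fibre of `p` over the image in `U_τ` of the closed
point `t` of the torus. -/
abbrev GeneralizedTestConfiguration.Fiber {r : ℕ} {τ : PointedCone ℝ (Fin r → ℝ)}
    {R : Type u} [CommRing R] [Algebra ℂ R] (D : GeneralizedTestConfiguration τ R)
    (t : Multiplicative (Fin r → ℤ) →* ℂˣ) : Type u :=
  R ⧸ (torusPointIdeal τ t).map D.proj

/-- An algebraic test deformation of `T ↷ Y` over `U_τ`: a generalized test configuration with a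
`T`-equivariant identification `p⁻¹(p_τ) = Y`, given by the comorphism `restr` of the closed
immersion of `Y` onto the scheme-theoretic fibre over `p_τ`. -/
structure AlgebraicTestDeformation {r : ℕ} (τ : PointedCone ℝ (Fin r → ℝ))
    {Y : Type u} [CommRing Y] [Algebra ℂ Y] (actY : TorusAction (Fin r → ℤ) Y)
    (R : Type u) [CommRing R] [Algebra ℂ R] extends GeneralizedTestConfiguration τ R where
  restr : R →ₐ[ℂ] Y
  restr_surjective : Function.Surjective restr
  ker_restr : RingHom.ker restr = (vertexIdeal τ).map proj
  restr_equivariant : action.IsEquivariant actY restr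

/-- An algebraic negative weight deformation of `(T ↷ Y, ξ)` over `U_τ`. -/
structure AlgebraicNegativeWeightDeformation {r : ℕ} (τ : PointedCone ℝ (Fin r → ℝ))
    {Y : Type u} [CommRing Y] [Algebra ℂ Y] (actY : TorusAction (Fin r → ℤ) Y)
    (ξ : Fin r → ℝ) (R : Type u) [CommRing R] [Algebra ℂ R]
    extends AlgebraicTestDeformation τ actY R where
  good : actY.IsGood
  mem_cone : ξ ∈ τ

/-! ## Deformations of negative `ξ`-weight -/

/-- An affine degeneration `(W, p, σ)` of `V` to `C`: an affine variety `Spec W` with a regular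
function `p`, an effective algebraic `ℂ^*`-action `σ` with `p (σ (z, x)) = z ^ μ * p (x)` for a
positive integer `μ`, isomorphisms `p⁻¹(s) ≅ V` for all `s ≠ 0`, and an isomorphism `p⁻¹(0) ≅ C`
(given by the comorphism `restr` of the closed immersion of `C`) that takes the restriction of `σ`
to the given `ℂ^*`-action on `C`. -/
structure AffineDegeneration (V : Type u) [CommRing V] [Algebra ℂ V]
    (C : Type u) [CommRing C] [Algebra ℂ C] (actC : TorusAction ℤ C)
    (W : Type u) [CommRing W] [Algebra ℂ W] where
  isDomain : IsDomain W
  finiteType : Algebra.FiniteType ℂ W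
  p : W
  σ : TorusAction ℤ W
  effective : σ.IsEffective
  μ : ℕ
  μ_pos : 0 < μ
  p_weight : σ.HasWeight (μ : ℤ) p
  restr : W →ₐ[ℂ] C
  restr_surjective : Function.Surjective restr
  ker_restr : RingHom.ker restr = Ideal.span {p}
  restr_equivariant : σ.IsEquivariant actC restr
  fiber_iso : ∀ s : ℂ, s ≠ 0 → Nonempty ((W ⧸ Ideal.span {p - algebraMap ℂ W s}) ≃ₐ[ℂ] V)

namespace AffineDegeneration

variable {V C W : Type u} [CommRing V] [Algebra ℂ V] [CommRing C] [Algebra ℂ C]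
  {actC : TorusAction ℤ C} [CommRing W] [Algebra ℂ W]

/-- After base change to `Spec ℂ[s]/(s^k)`, `k ≥ 1`, the deformation `p` of `C` is isomorphic to
the trivial deformation `C × Spec ℂ[s]/(s^k)`, by an isomorphism over `Spec ℂ[s]/(s^k)` that is
the identity on the central fibre `C`. -/
def IsTrivialModulo (D : AffineDegeneration V C actC W) (k : ℕ) : Prop :=
  ∃ e : (W ⧸ Ideal.span {D.p ^ k}) ≃ₐ[ℂ] (C[X] ⧸ Ideal.span {(Polynomial.X : C[X]) ^ k}),
    e (Ideal.Quotient.mk _ D.p) = Ideal.Quotient.mk _ Polynomial.X ∧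
      ∀ (w : W) (f : C[X]), e (Ideal.Quotient.mk _ w) = Ideal.Quotient.mk _ f →
        f.coeff 0 = D.restr w

/-- The vanishing order of the deformation: the largest `k` such that the deformation is
trivial modulo `s^k`, or `∞` if there is no largest one. -/
def vanishingOrder (D : AffineDegeneration V C actC W) : ℕ∞ :=
  ⨆ (k : ℕ) (_ : 1 ≤ k ∧ D.IsTrivialModulo k), (k : ℕ∞)

end AffineDegeneration

/-- The affine variety `V` is a deformation of negative `ξ`-weight of the affine variety `C` with
an action of `T = 𝔾_m ⊗ ℤ^r`, where `ξ ∈ Lie T = ℝ^r`: there are `ξ_i → ξ` and `c_i > 0` such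
that `c_i ξ_i` generates an effective algebraic `ℂ^*`-action on `C` (it is a cocharacter
`l_i` of `T` that acts effectively), and affine degenerations `(W_i, p_i, σ_i)` of `V` to `C` with
`σ_i` restricting to this action on `C`, such that with the vanishing order `k_i` and the
weight `μ_i` of `p_i` the numbers `λ_i = - k_i μ_i / c_i` are negative and bounded away from
zero. -/
def IsNegativeWeightDeformation {r : ℕ} {C : Type u} [CommRing C] [Algebra ℂ C]
    (actC : TorusAction (Fin r → ℤ) C) (ξ : Fin r → ℝ)
    (V : Type u) [CommRing V] [Algebra ℂ V] : Prop :=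
  IsDomain V ∧ Algebra.FiniteType ℂ V ∧
    ∃ (ξs : ℕ → Fin r → ℝ) (c : ℕ → ℝ) (l : ℕ → Fin r → ℤ),
      Tendsto ξs atTop (𝓝 ξ) ∧
      (∀ i, 0 < c i) ∧
      (∀ i j, c i * ξs i j = (l i j : ℝ)) ∧
      (∀ i, (actC.restrict (pairing (l i))).IsEffective) ∧
      ∃ δ : ℝ, 0 < δ ∧
        ∀ i, ∃ (W : Type u) (_ : CommRing W) (_ : Algebra ℂ W)
          (D : AffineDegeneration V C (actC.restrict (pairing (l i))) W),
          ENNReal.ofReal δ ≤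
            ((D.vanishingOrder * (D.μ : ℕ∞) : ℕ∞) : ℝ≥0∞) / ENNReal.ofReal (c i)

end NegativeWeight

end

/-! Approximate `ξ` by rational vectors `ξ_i` with `c_i ξ_i = l_i` primitive in `N`. Since `ξ` is
interior to `τ`, every non-zero `m ∈ S_τ` satisfies `⟨m, ξ_i⟩ ≥ ε` for a uniform `ε > 0`. Hence the
curve `s ↦ l_i(s) • t` extends over `s = 0` with value `p_τ`. Let `W_i` be the pullback of `𝒴` to
this curve, with `s` as the function `p_i`.

The fibre of `W_i` over `0` is `Y`. Translation by `l_i(a)` identifies the fibre over `a ≠ 0` with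
the fibre over `t`. The action of `l_i` lifts with `s` of weight `μ_i = 1`. Modulo `s^k` with `k ≤
⟨m, l_i⟩` for all non-zero `m ∈ S_τ`, the curve is constant at `p_τ`, so the deformation is trivial
(`curveDegeneration_isTrivialModulo`). The choice `k = ⌈c_i ε⌉` gives `k_i μ_i / c_i ≥ ε`, so `δ =
ε` works.

The delicate point is that `W_i` is integral (`CurveRing.isDomain`). By flatness `s` is a
non-zero-divisor (`eq_zero_of_s_mul`). The torus element carrying the image of the generic point of
`𝒴` to `l_i(s) • t` defines a homomorphism to a field. Clearing its denominators costs only powers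
of `s` on `W_i`, so its kernel is exactly the ideal of `W_i`. The constant curve `l = 0` yields
integrality of the general fibre itself. -/

noncomputable section

namespace NegativeWeight

/-! ### Torus actions through semi-invariants -/

namespace TorusAction

variable {M L : Type*} [AddCommGroup M] [AddCommGroup L]
variable {R S B : Type*} [CommRing R] [Algebra ℂ R] [CommRing S] [Algebra ℂ S]
  [CommRing B] [Algebra ℂ B]

lemma hasWeight_coeff (a : TorusAction M R) (f : R) (m : M) :
    a.HasWeight m ((a.coact f).coeff m) :=
  a.coassoc f m

/-- Every function is a sum of semi-invariants. -/
lemma induction_hasWeight (a : TorusAction M R) {P : R → Prop} (zero : P 0)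
    (add : ∀ f g, P f → P g → P (f + g)) (weight : ∀ m f, a.HasWeight m f → P f) (f : R) :
    P f := by
  classical
  rw [← a.counit f, Finsupp.sum]
  exact Finset.sum_induction _ P add zero fun m _ => weight m _ (a.hasWeight_coeff f m)

lemma algHom_ext_of_hasWeight (a : TorusAction M R) {φ ψ : R →ₐ[ℂ] B}
    (h : ∀ m f, a.HasWeight m f → φ f = ψ f) : φ = ψ := by
  ext f
  refine a.induction_hasWeight (P := fun f => φ f = ψ f) (by simp) ?_ h f
  intro f g hf hg
  simp [hf, hg]

/-- The homomorphism that multiplies the value of `φ` at a semi-invariant by the value of the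
character `u` at its weight. -/
def twist (a : TorusAction M R) (φ : R →ₐ[ℂ] B) (u : Multiplicative M →* B) : R →ₐ[ℂ] B :=
  (AddMonoidAlgebra.liftNCAlgHom φ u fun _ _ => Commute.all _ _).comp a.coact

lemma twist_of_hasWeight {a : TorusAction M R} (φ : R →ₐ[ℂ] B) (u : Multiplicative M →* B)
    {m : M} {f : R} (h : a.HasWeight m f) :
    a.twist φ u f = φ f * u (Multiplicative.ofAdd m) := by
  have h' : a.coact f = AddMonoidAlgebra.single m f := h
  simp [twist, h']

lemma translate_of_hasWeight {a : TorusAction M R} (t : Multiplicative M →* ℂˣ)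
    {m : M} {f : R} (h : a.HasWeight m f) :
    a.translate t f = ((t (Multiplicative.ofAdd m) : ℂˣ) : ℂ) • f := by
  have h' : a.coact f = AddMonoidAlgebra.single m f := h
  simp [translate, h']

/-- A point of `𝔾_m` scales a weight-one function by itself, so it can be read off from that
function. This is used for the coordinate of the curve. -/
lemma isEffective_of_hasWeight_one [Nontrivial R] {a : TorusAction ℤ R} {f : R}
    (hf : ∀ z : ℂ, z • f = f → z = 1) (h : a.HasWeight 1 f) : a.IsEffective := by
  intro t ht
  have h1 := ht f
  rw [translate_of_hasWeight t h] at h1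
  have h2 := hf _ h1
  ext
  simpa using h2

lemma translate_restrict (a : TorusAction M R) (φ : M →+ L) (t : Multiplicative L →* ℂˣ) (f : R) :
    (a.restrict φ).translate t f = a.translate (t.comp φ.toMultiplicative) f := by
  have h : ((a.restrict φ).coact f).coeff = Finsupp.mapDomain φ (a.coact f).coeff := rfl
  rw [translate, h, Finsupp.sum_mapDomain_index (fun _ => smul_zero _) (fun _ _ _ => smul_add _ _ _)]
  rfl

/-- A surjection of character lattices is dual to an injection of tori. -/
lemma IsEffective.restrict {a : TorusAction M R} (ha : a.IsEffective) {φ : M →+ L}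
    (hφ : Function.Surjective φ) : (a.restrict φ).IsEffective := by
  intro t ht
  have h := ha (t.comp φ.toMultiplicative) fun f => by rw [← translate_restrict, ht]
  ext x
  obtain ⟨m, hm⟩ := hφ x
  have h' := DFunLike.congr_fun h (Multiplicative.ofAdd m)
  have : t (Multiplicative.ofAdd (φ m)) = 1 := h'
  rw [hm] at this
  simpa using congrArg Units.val this

lemma HasWeight.restrict {a : TorusAction M R} {m : M} {f : R} (h : a.HasWeight m f)
    (φ : M →+ L) : (a.restrict φ).HasWeight (φ m) f := by
  have h' : a.coact f = AddMonoidAlgebra.single m f := h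
  simp [HasWeight, TorusAction.restrict, h']

/-- A coaction homomorphism for which the algebra is generated by semi-invariants is an action. -/
def ofAdjoin (c : R →ₐ[ℂ] AddMonoidAlgebra R M)
    (h : Algebra.adjoin ℂ {f | ∃ m, c f = AddMonoidAlgebra.single m f} = ⊤) :
    TorusAction M R := by
  have key : ∀ P : R → Prop, P 0 → (∀ f g, P f → P g → P (f + g)) →
      (∀ m f, c f = AddMonoidAlgebra.single m f → P f) → ∀ f, P f := by
    intro P zero add weight f
    -- Products of semi-invariants are semi-invariants, so the algebra they generate is their linear
    -- span, and additive statements need checking only on them.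
    let T : Submonoid R :=
      { carrier := {f | ∃ m, c f = AddMonoidAlgebra.single m f}
        one_mem' := ⟨0, by rw [map_one]; rfl⟩
        mul_mem' := by
          rintro f g ⟨m, hf⟩ ⟨n, hg⟩
          exact ⟨m + n, by rw [map_mul, hf, hg, AddMonoidAlgebra.single_mul_single]⟩ }
    have hT : Submonoid.closure {f | ∃ m, c f = AddMonoidAlgebra.single m f} = T :=
      Submonoid.closure_eq T
    have hf : f ∈ Submodule.span ℂ (T : Set R) := by
      rw [← hT, ← Algebra.adjoin_eq_span, h]
      trivial
    induction hf using Submodule.closure_induction with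
    | zero => exact zero
    | add f g _ _ hf hg => exact add f g hf hg
    | smul_mem z f hf =>
      obtain ⟨m, hm⟩ := hf
      exact weight m _ (by rw [map_smul, hm, AddMonoidAlgebra.smul_single])
  exact
    { coact := c
      counit := by
        classical
        refine key _ (by simp) ?_ ?_
        · intro f g hf hg
          rw [map_add, AddMonoidAlgebra.coeff_add, Finsupp.sum_add_index' (fun _ => rfl)
            (fun _ _ _ => rfl), hf, hg]
        · intro m f hf
          simp [hf]
      coassoc := by
        classical
        refine key _ (by simp) ?_ ?_
        · intro f g hf hg m
          rw [map_add, AddMonoidAlgebra.coeff_add, Finsupp.add_apply, map_add, hf, hg,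
            AddMonoidAlgebra.single_add]
        · intro m f hf n
          rw [hf, AddMonoidAlgebra.coeff_single]
          by_cases hmn : m = n
          · subst hmn
            simp [hf]
          · simp [hmn] }

end TorusAction

end NegativeWeight

/-! ### Lattice and cone geometry -/

namespace NegativeWeight

variable {r : ℕ}

lemma pairing_apply (l m : Fin r → ℤ) : pairing l m = ∑ j, m j * l j := rfl

lemma mem_dualMonoid_of_zsmul {τ : PointedCone ℝ (Fin r → ℝ)} {k : ℤ} (hk : 0 < k)
    {m : Fin r → ℤ} (h : k • m ∈ dualMonoid τ) : m ∈ dualMonoid τ := by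
  intro x hx
  have h1 : 0 ≤ realPairing (k • m) x := h x hx
  have h2 : realPairing (k • m) x = k * realPairing m x := by
    simp [realPairing, Finset.mul_sum, mul_assoc]
  rw [h2] at h1
  exact nonneg_of_mul_nonneg_right h1 (by exact_mod_cast hk)

/-- The differences of elements of `S_τ`. -/
def dualGroup (τ : PointedCone ℝ (Fin r → ℝ)) : Submodule ℤ (Fin r → ℤ) :=
  AddSubgroup.toIntSubmodule
    { carrier := {m | ∃ a ∈ dualMonoid τ, ∃ b ∈ dualMonoid τ, m = a - b}
      zero_mem' := ⟨0, zero_mem _, 0, zero_mem _, by simp⟩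
      add_mem' := by
        rintro _ _ ⟨a, ha, b, hb, rfl⟩ ⟨c, hc, d, hd, rfl⟩
        exact ⟨a + c, add_mem ha hc, b + d, add_mem hb hd, by abel⟩
      neg_mem' := by
        rintro _ ⟨a, ha, b, hb, rfl⟩
        exact ⟨b, hb, a, ha, by abel⟩ }

lemma mem_dualGroup {τ : PointedCone ℝ (Fin r → ℝ)} {m : Fin r → ℤ} :
    m ∈ dualGroup τ ↔ ∃ a ∈ dualMonoid τ, ∃ b ∈ dualMonoid τ, m = a - b := Iff.rfl

/-- If `k m = a - b`, then `k (m + b) = a + (k - 1) b` lies in `S_τ`, which is saturated. This makes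
the quotient by the generated group torsion-free. -/
lemma mem_dualGroup_of_smul {τ : PointedCone ℝ (Fin r → ℝ)} {k : ℤ} (hk : 0 < k)
    {m : Fin r → ℤ} (h : k • m ∈ dualGroup τ) : m ∈ dualGroup τ := by
  obtain ⟨a, ha, b, hb, hab⟩ := mem_dualGroup.mp h
  refine mem_dualGroup.mpr ⟨m + b, mem_dualMonoid_of_zsmul hk ?_, b, hb, by abel⟩
  have : k • (m + b) = a + (k - 1).toNat • b := by
    rw [smul_add, hab, ← natCast_zsmul, Int.toNat_of_nonneg (by omega), sub_smul, one_smul]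
    abel
  rw [this]
  exact add_mem ha (nsmul_mem hb _)

instance (τ : PointedCone ℝ (Fin r → ℝ)) :
    Module.IsTorsionFree ℤ ((Fin r → ℤ) ⧸ dualGroup τ) := by
  rw [Module.isTorsionFree_iff_smul_eq_zero]
  intro k x h
  by_contra! hc
  obtain ⟨hk, hx⟩ := hc
  induction x using Submodule.Quotient.induction_on with
  | H m =>
    apply hx
    rw [← Submodule.Quotient.mk_smul, Submodule.Quotient.mk_eq_zero] at h
    rw [Submodule.Quotient.mk_eq_zero]
    rcases lt_or_gt_of_ne hk with hk | hk
    · refine mem_dualGroup_of_smul (k := -k) (by omega) ?_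
      rw [neg_smul]
      exact neg_mem h
    · exact mem_dualGroup_of_smul hk h

/-- The group generated by `S_τ` is a direct summand of the character lattice. -/
lemma exists_retraction_dualGroup (τ : PointedCone ℝ (Fin r → ℝ)) :
    ∃ ρ : (Fin r → ℤ) →+ (Fin r → ℤ),
      (∀ m, ∃ a b : dualMonoid τ, ρ m = (a : Fin r → ℤ) - b) ∧
      ∀ m : dualMonoid τ, ρ m = m := by
  -- The quotient is finitely generated and torsion-free over `ℤ`, hence projective, so the quotient
  -- map has a section `g`.
  obtain ⟨g, hg⟩ := Module.projective_lifting_property (dualGroup τ).mkQ LinearMap.id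
    (Submodule.mkQ_surjective _)
  refine ⟨(LinearMap.id - g ∘ₗ (dualGroup τ).mkQ).toAddMonoidHom, fun m => ?_, fun m => ?_⟩
  · have h : m - g ((dualGroup τ).mkQ m) ∈ dualGroup τ := by
      rw [← Submodule.Quotient.mk_eq_zero, ← Submodule.mkQ_apply, map_sub, sub_eq_zero]
      exact (LinearMap.congr_fun hg _).symm
    obtain ⟨a, ha, b, hb, hab⟩ := mem_dualGroup.mp h
    exact ⟨⟨a, ha⟩, ⟨b, hb⟩, hab⟩
  · have h : (dualGroup τ).mkQ (m : Fin r → ℤ) = 0 := by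
      rw [Submodule.mkQ_apply, Submodule.Quotient.mk_eq_zero]
      exact mem_dualGroup.mpr ⟨m, m.2, 0, zero_mem _, by simp⟩
    simp only [LinearMap.toAddMonoidHom_coe, LinearMap.sub_apply, LinearMap.id_apply,
      LinearMap.comp_apply, h, map_zero, sub_zero]

/-- Near an interior point of the cone the non-zero characters in `S_τ` are bounded below. -/
lemma exists_le_realPairing {τ : PointedCone ℝ (Fin r → ℝ)} {ξ : Fin r → ℝ}
    (hξ : ξ ∈ interior (τ : Set (Fin r → ℝ))) :
    ∃ ε : ℝ, 0 < ε ∧ ∀ x, dist x ξ < ε → ∀ m ∈ dualMonoid τ, m ≠ 0 → ε ≤ realPairing m x := by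
  obtain ⟨ρ, hρ, hball⟩ := Metric.mem_nhds_iff.mp (mem_interior_iff_mem_nhds.mp hξ)
  refine ⟨ρ / 2, by positivity, fun x hx m hm hm0 => ?_⟩
  obtain ⟨j, hj⟩ := Function.ne_iff.mp hm0
  have hj1 : (1 : ℝ) ≤ |(m j : ℝ)| := by exact_mod_cast Int.one_le_abs hj
  obtain ⟨s, hs, h3⟩ : ∃ s : ℝ, |s| ≤ 1 ∧ (m j : ℝ) * s = |(m j : ℝ)| := by
    refine ⟨((SignType.sign (m j : ℝ) : SignType) : ℝ), ?_, self_mul_sign _⟩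
    rcases lt_trichotomy (m j : ℝ) 0 with h | h | h <;> simp [h]
  -- Half of the radius is for `x`, the other half for a shift `v` along the `j`-th axis in the
  -- direction of the sign of `m j`. As `x - v` stays in `τ`, `⟨m, x⟩ ≥ ⟨m, v⟩ = |m j| ρ / 2 ≥ ρ /
  -- 2`.
  obtain ⟨v, hv, hmv⟩ : ∃ v : Fin r → ℝ, ‖v‖ ≤ ρ / 2 ∧
      realPairing m v = (m j : ℝ) * (ρ / 2 * s) := by
    refine ⟨Pi.single j (ρ / 2 * s), ?_, by simp [realPairing, Pi.single_apply]⟩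
    rw [Pi.norm_single, Real.norm_eq_abs, abs_mul, abs_of_pos (by positivity : 0 < ρ / 2)]
    exact mul_le_of_le_one_right (by positivity) hs
  have hy : x - v ∈ τ := by
    refine hball (Metric.mem_ball.mpr ?_)
    have h1 : dist (x - v) x = ‖v‖ := by rw [dist_eq_norm, sub_sub_cancel_left, norm_neg]
    linarith [dist_triangle (x - v) x ξ]
  have h := hm _ hy
  have h2 : realPairing m (x - v) = realPairing m x - realPairing m v := by
    simp [realPairing, mul_sub, Finset.sum_sub_distrib]
  rw [h2, hmv] at h
  nlinarith

/-- A non-zero integral vector is a positive multiple of a primitive one. -/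
lemma exists_primitive {L : Fin r → ℤ} (hL : L ≠ 0) :
    ∃ (g : ℤ) (l : Fin r → ℤ), 0 < g ∧ (∀ j, L j = g * l j) ∧
      Function.Surjective (pairing l) := by
  obtain ⟨g, hg⟩ := Int.subgroup_cyclic (pairing L).range
  have hg' : (pairing L).range = AddSubgroup.zmultiples |g| := by
    rw [hg, ← AddSubgroup.zmultiples_eq_closure]
    rcases abs_choice g with h | h <;> simp [h]
  have hmem : ∀ j, ∃ k, L j = |g| * k := by
    intro j
    have : L j ∈ (pairing L).range := ⟨Pi.single j 1, by simp [pairing_apply, Pi.single_apply]⟩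
    rw [hg', Int.mem_zmultiples_iff] at this
    exact this
  choose l hl using hmem
  have hg0 : |g| ≠ 0 := by
    intro h
    exact hL (funext fun j => by rw [hl, h, zero_mul]; rfl)
  refine ⟨|g|, l, by positivity, hl, fun k => ?_⟩
  -- The generator `|g|` is itself a value of the pairing with `L = |g| l`, so the pairing with `l`
  -- takes the value `1`.
  obtain ⟨m, hm⟩ : |g| ∈ (pairing L).range := by
    rw [hg']
    exact AddSubgroup.mem_zmultiples _
  have h1 : |g| * pairing l m = |g| := by
    conv_rhs => rw [← hm]
    simp only [pairing_apply, Finset.mul_sum]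
    exact Finset.sum_congr rfl fun j _ => by rw [hl]; ring
  have h2 : pairing l m = 1 := by
    refine mul_left_cancel₀ hg0 ?_
    rw [h1, mul_one]
  exact ⟨k • m, by rw [map_zsmul, h2]; simp⟩

/-- A non-zero vector is approximated by positive multiples of primitive integral vectors. -/
lemma exists_primitive_near {ξ : Fin r → ℝ} (hξ : ξ ≠ 0) {η : ℝ} (hη : 0 < η) :
    ∃ (x : Fin r → ℝ) (c : ℝ) (l : Fin r → ℤ), dist x ξ < η ∧ 0 < c ∧
      (∀ j, c * x j = l j) ∧ Function.Surjective (pairing l) := by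
  -- An error below `‖ξ‖` keeps the rational approximation non-zero.
  have hpos : 0 < min η ‖ξ‖ := lt_min hη (norm_pos_iff.mpr hξ)
  have hq : ∀ j, ∃ q : ℚ, |(q : ℝ) - ξ j| < min η ‖ξ‖ := by
    intro j
    obtain ⟨q, hq⟩ := Rat.denseRange_cast (𝕜 := ℝ) |>.exists_dist_lt (ξ j) hpos
    exact ⟨q, by rwa [dist_comm, Real.dist_eq] at hq⟩
  choose q hq using hq
  have hd : dist (fun j => (q j : ℝ)) ξ < min η ‖ξ‖ :=
    (dist_pi_lt_iff hpos).mpr fun j => by rw [Real.dist_eq]; exact hq j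
  let d : ℤ := ∏ j, ((q j).den : ℤ)
  have hd0 : 0 < d := Finset.prod_pos fun j _ => by exact_mod_cast (q j).den_pos
  have hL : ∀ j, ∃ L : ℤ, (L : ℝ) = d * q j := by
    intro j
    obtain ⟨e, he⟩ : ((q j).den : ℤ) ∣ d := Finset.dvd_prod_of_mem _ (Finset.mem_univ j)
    refine ⟨e * (q j).num, ?_⟩
    have h1 : ((q j).num : ℝ) = (q j) * (q j).den := by exact_mod_cast (Rat.mul_den_eq_num _).symm
    rw [he]
    push_cast
    rw [h1]
    ring
  choose L hL using hL
  have hL0 : L ≠ 0 := by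
    rintro rfl
    have : (fun j => (q j : ℝ)) = 0 := by
      funext j
      have := hL j
      simp only [Pi.zero_apply, Int.cast_zero, zero_eq_mul, Int.cast_eq_zero, hd0.ne',
        false_or] at this
      exact this
    rw [this, dist_zero_left] at hd
    exact absurd (hd.trans_le (min_le_right _ _)) (lt_irrefl _)
  obtain ⟨g, l, hg, hgl, hl⟩ := exists_primitive hL0
  refine ⟨fun j => q j, d / g, l, hd.trans_le (min_le_left _ _), by positivity, fun j => ?_, hl⟩
  have hg' : (g : ℝ) ≠ 0 := by exact_mod_cast hg.ne'
  have := hL j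
  rw [hgl] at this
  push_cast at this
  field_simp
  linarith

end NegativeWeight

/-! ### The pullback to a curve and its flatness -/

namespace NegativeWeight

variable {r : ℕ} {τ : PointedCone ℝ (Fin r → ℝ)}

lemma chi_zero : (chi 0 : ToricRing τ) = 1 := rfl

lemma chi_add (m n : dualMonoid τ) : chi (m + n) = chi m * chi n := by
  simp [chi, AddMonoidAlgebra.single_mul_single]

lemma chi_ne_zero (m : dualMonoid τ) : chi m ≠ 0 := by
  simp [chi]

/-- The value of `χ^m` at the point `t` of the torus. -/
def charValue (t : Multiplicative (Fin r → ℤ) →* ℂˣ) (m : Fin r → ℤ) : ℂ :=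
  ((t (Multiplicative.ofAdd m) : ℂˣ) : ℂ)

lemma charValue_zero (t : Multiplicative (Fin r → ℤ) →* ℂˣ) : charValue t 0 = 1 := by
  simp [charValue]

lemma charValue_add (t : Multiplicative (Fin r → ℤ) →* ℂˣ) (m n : Fin r → ℤ) :
    charValue t (m + n) = charValue t m * charValue t n := by
  simp [charValue]

lemma charValue_ne_zero (t : Multiplicative (Fin r → ℤ) →* ℂˣ) (m : Fin r → ℤ) :
    charValue t m ≠ 0 :=
  Units.ne_zero _

variable {R : Type u} [CommRing R] [Algebra ℂ R]

/-- The ideal of the pullback of `Spec R → U_τ` along the curve `s ↦ l (s) • t`. -/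
def curveIdeal (proj : ToricRing τ →ₐ[ℂ] R) (l : Fin r → ℤ)
    (t : Multiplicative (Fin r → ℤ) →* ℂˣ) : Ideal R[X] :=
  Ideal.span {g | ∃ m : dualMonoid τ, g = Polynomial.C (proj (chi m)) -
    algebraMap ℂ R[X] (charValue t m) * Polynomial.X ^ (pairing l m).toNat}

/-- The coordinate ring of the pullback of `Spec R → U_τ` along the curve `s ↦ l (s) • t`. -/
abbrev CurveRing (proj : ToricRing τ →ₐ[ℂ] R) (l : Fin r → ℤ)
    (t : Multiplicative (Fin r → ℤ) →* ℂˣ) : Type u :=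
  R[X] ⧸ curveIdeal proj l t

namespace CurveRing

variable {proj : ToricRing τ →ₐ[ℂ] R} {l : Fin r → ℤ} {t : Multiplicative (Fin r → ℤ) →* ℂˣ}

variable (proj l t) in
/-- The coordinate of the curve. -/
def s : CurveRing proj l t := Ideal.Quotient.mk _ Polynomial.X

variable (proj l t) in
/-- The comorphism of the projection to `Spec R`. -/
def incl : R →ₐ[ℂ] CurveRing proj l t :=
  (Ideal.Quotient.mkₐ ℂ (curveIdeal proj l t)).comp Polynomial.CAlgHom

lemma incl_chi (m : dualMonoid τ) : incl proj l t (proj (chi m)) =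
    algebraMap ℂ _ (charValue t m) * s proj l t ^ (pairing l m).toNat := by
  have h : Polynomial.C (proj (chi m)) - algebraMap ℂ R[X] (charValue t m) *
      Polynomial.X ^ (pairing l m).toNat ∈ curveIdeal proj l t := Ideal.subset_span ⟨m, rfl⟩
  have h' := Ideal.Quotient.eq.mpr h
  simp only [map_mul, map_pow] at h'
  exact h'

lemma algHom_ext {B : Type*} [CommRing B] [Algebra ℂ B] {φ ψ : CurveRing proj l t →ₐ[ℂ] B}
    (h : φ.comp (incl proj l t) = ψ.comp (incl proj l t))
    (hs : φ (s proj l t) = ψ (s proj l t)) : φ = ψ :=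
  Ideal.Quotient.algHom_ext _ (Polynomial.algHom_ext' h hs)

/-- The homomorphism out of the ring of the pullback that is given on `R` and on the
coordinate. -/
def lift {B : Type*} [CommRing B] [Algebra ℂ B] (φ : R →ₐ[ℂ] B) (b : B)
    (h : ∀ m : dualMonoid τ, φ (proj (chi m)) =
      algebraMap ℂ B (charValue t m) * b ^ (pairing l m).toNat) : CurveRing proj l t →ₐ[ℂ] B :=
  Ideal.Quotient.liftₐ _ (Polynomial.aevalTower φ b) <| by
    intro g hg
    have : curveIdeal proj l t ≤
        RingHom.ker (Polynomial.aevalTower φ b) := by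
      rw [curveIdeal, Ideal.span_le]
      rintro _ ⟨m, rfl⟩
      simp only [SetLike.mem_coe, RingHom.mem_ker, map_sub, map_mul, map_pow, AlgHom.commutes]
      simp [h]
    exact this hg

section lift

variable {B : Type*} [CommRing B] [Algebra ℂ B] {φ : R →ₐ[ℂ] B} {b : B}
  {h : ∀ m : dualMonoid τ, φ (proj (chi m)) =
    algebraMap ℂ B (charValue t m) * b ^ (pairing l m).toNat}

@[simp] lemma lift_incl (f : R) : lift φ b h (incl proj l t f) = φ f :=
  Polynomial.aevalTower_C φ b f

@[simp] lemma lift_s : lift φ b h (s proj l t) = b :=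
  Polynomial.aevalTower_X φ b

end lift

lemma adjoin_range_incl :
    Algebra.adjoin ℂ (Set.range (incl proj l t) ∪ {s proj l t}) = ⊤ := by
  rw [eq_top_iff]
  rintro w -
  obtain ⟨g, rfl⟩ := Ideal.Quotient.mk_surjective w
  induction g using Polynomial.induction_on' with
  | add p q hp hq =>
    rw [map_add]
    exact add_mem hp hq
  | monomial n a =>
    rw [← Polynomial.C_mul_X_pow_eq_monomial, map_mul, map_pow]
    exact mul_mem (Algebra.subset_adjoin (Set.mem_union_left _ ⟨a, rfl⟩))
      (pow_mem (Algebra.subset_adjoin (Set.mem_union_right _ (Set.mem_singleton _))) _)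

variable (l t) in
/-- The comorphism of the curve `s ↦ l (s) • t` in `U_τ`. -/
def curve (hl : ∀ m ∈ dualMonoid τ, 0 ≤ pairing l m) : ToricRing τ →ₐ[ℂ] ℂ[X] :=
  AddMonoidAlgebra.lift ℂ ℂ[X] (dualMonoid τ)
    { toFun m := Polynomial.C (charValue t m.toAdd) *
        Polynomial.X ^ (pairing l (m.toAdd : Fin r → ℤ)).toNat
      map_one' := by simp [charValue_zero]
      map_mul' m n := by
        simp only [toAdd_mul, AddSubmonoid.coe_add, charValue_add, map_add, map_mul]
        rw [Int.toNat_add (hl _ (SetLike.coe_mem _)) (hl _ (SetLike.coe_mem _)), pow_add]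
        ring }

/-- The pullback of a flat morphism to the curve is flat. -/
lemma eq_zero_of_s_mul (hproj : proj.toRingHom.Flat)
    (hl : ∀ m ∈ dualMonoid τ, 0 ≤ pairing l m) {w : CurveRing proj l t}
    (hw : s proj l t * w = 0) : w = 0 := by
  let A := ToricRing τ
  let _ : Algebra A R := proj.toRingHom.toAlgebra
  let _ : Algebra A ℂ[X] := (curve l t hl).toRingHom.toAlgebra
  have : Module.Flat A R := hproj
  let i : R →ₐ[A] CurveRing proj l t :=
    { (incl proj l t).toRingHom with commutes' := fun a => rfl }
  have hj : ((Ideal.Quotient.mkₐ ℂ (curveIdeal proj l t)).comp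
      (Polynomial.mapAlgHom (Algebra.ofId ℂ R))).comp (curve l t hl) =
      (incl proj l t).comp proj := by
    refine AddMonoidAlgebra.algHom_ext (fun m => ?_) (Subsingleton.elim _ _)
    change _ = incl proj l t (proj (chi m))
    rw [incl_chi]
    simp [curve, s]
    rfl
  let j : ℂ[X] →ₐ[A] CurveRing proj l t :=
    { ((Ideal.Quotient.mkₐ ℂ (curveIdeal proj l t)).comp
      (Polynomial.mapAlgHom (Algebra.ofId ℂ R))).toRingHom with
      commutes' := fun a => AlgHom.congr_fun hj a }
  -- The pullback is `R ⊗_A ℂ[X]`, but only half of this is needed: `ψ ∘ Φ = id` makes `Φ`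
  -- injective.
  let ψ : TensorProduct A R ℂ[X] →ₐ[A] CurveRing proj l t := Algebra.TensorProduct.productMap i j
  let φ : R[X] →+* TensorProduct A R ℂ[X] := Polynomial.eval₂RingHom
    (Algebra.TensorProduct.includeLeft (R := A) (S := A) (A := R) (B := ℂ[X])).toRingHom
    ((1 : R) ⊗ₜ[A] (Polynomial.X : ℂ[X]))
  have hC (z : ℂ) : (algebraMap ℂ R z) ⊗ₜ[A] (1 : ℂ[X]) = (1 : R) ⊗ₜ[A] Polynomial.C z := by
    have h1 : algebraMap ℂ R z = (algebraMap ℂ A z) • (1 : R) := by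
      rw [Algebra.smul_def, mul_one]
      exact (proj.commutes z).symm
    have h2 : Polynomial.C z = (algebraMap ℂ A z) • (1 : ℂ[X]) := by
      rw [Algebra.smul_def, mul_one]
      exact ((curve l t hl).commutes z).symm
    rw [h1, h2, TensorProduct.smul_tmul]
  have hφ : ∀ g ∈ curveIdeal proj l t, φ g = 0 := by
    have : curveIdeal proj l t ≤ RingHom.ker φ := by
      rw [curveIdeal, Ideal.span_le]
      rintro _ ⟨m, rfl⟩
      have h1 : proj (chi m) = (chi m : A) • (1 : R) := by
        rw [Algebra.smul_def, mul_one]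
        rfl
      have h2 : (chi m : A) • (1 : ℂ[X]) = Polynomial.C (charValue t m) *
          Polynomial.X ^ (pairing l m).toNat := by
        rw [Algebra.smul_def, mul_one]
        change curve l t hl (chi m) = _
        simp [curve, chi]
      simp only [SetLike.mem_coe, RingHom.mem_ker, map_sub, sub_eq_zero, map_mul, map_pow]
      have h3 : φ (algebraMap ℂ R[X] (charValue t m)) =
          (algebraMap ℂ R (charValue t m)) ⊗ₜ[A] (1 : ℂ[X]) := by
        simp [φ, Polynomial.algebraMap_apply]
      have h4 : φ (Polynomial.C (proj (chi m))) = (proj (chi m)) ⊗ₜ[A] (1 : ℂ[X]) := by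
        simp [φ]
      have h5 : φ Polynomial.X = (1 : R) ⊗ₜ[A] (Polynomial.X : ℂ[X]) := by
        simp [φ]
      rw [h3, h4, h5, hC, h1, TensorProduct.smul_tmul, h2, Algebra.TensorProduct.tmul_pow,
        Algebra.TensorProduct.tmul_mul_tmul, one_pow, one_mul]
    exact fun g hg => this hg
  let Φ : CurveRing proj l t →+* TensorProduct A R ℂ[X] := Ideal.Quotient.lift _ φ hφ
  have hΦs : Φ (s proj l t) = (1 : R) ⊗ₜ[A] (Polynomial.X : ℂ[X]) := by
    simp [Φ, s, φ]
  have hψΦ : ψ.toRingHom.comp Φ = RingHom.id _ := by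
    refine Ideal.Quotient.ringHom_ext (Polynomial.ringHom_ext (fun f => ?_) ?_)
    · simp [Φ, φ, ψ, i, incl]
    · simp [Φ, φ, ψ, j]
  have hmul (z : TensorProduct A R ℂ[X]) : (1 : R) ⊗ₜ[A] (Polynomial.X : ℂ[X]) * z =
      (LinearMap.mulLeft A (Polynomial.X : ℂ[X])).lTensor R z := by
    induction z with
    | zero => simp
    | tmul x y => simp
    | add x y hx hy => rw [mul_add, hx, hy, map_add]
  -- Multiplication by `X` is injective and `A`-linear on `ℂ[X]`; flatness of `R` preserves this
  -- under tensoring.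
  have hinj : Function.Injective ((LinearMap.mulLeft A (Polynomial.X : ℂ[X])).lTensor R) :=
    Module.Flat.lTensor_preserves_injective_linearMap _ fun x y hxy =>
      mul_left_cancel₀ Polynomial.X_ne_zero hxy
  have h0 : Φ w = 0 := by
    apply hinj
    rw [← hmul, ← hΦs, ← map_mul, hw, map_zero, map_zero]
  have := RingHom.congr_fun hψΦ w
  simp only [RingHom.comp_apply, h0, map_zero, RingHom.id_apply] at this
  exact this.symm

end CurveRing

end NegativeWeight

/-! ### Integrality of the pullback -/

namespace NegativeWeight

variable {r : ℕ} {τ : PointedCone ℝ (Fin r → ℝ)}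

/-- A homomorphism from `S_τ` to an abelian group extends to the character lattice along a
homomorphism to the differences of elements of `S_τ`. -/
lemma exists_extend_dualMonoid {G : Type*} [CommGroup G]
    (v : Multiplicative (dualMonoid τ) →* G) {ρ : (Fin r → ℤ) →+ (Fin r → ℤ)}
    (hρ : ∀ m, ∃ a b : dualMonoid τ, ρ m = (a : Fin r → ℤ) - b) :
    ∃ U : Multiplicative (Fin r → ℤ) →* G, ∀ m (a b : dualMonoid τ),
      ρ m = (a : Fin r → ℤ) - b →
        U (Multiplicative.ofAdd m) = v (Multiplicative.ofAdd a) / v (Multiplicative.ofAdd b) := by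
  have hv (a b : dualMonoid τ) : v (Multiplicative.ofAdd (a + b)) =
      v (Multiplicative.ofAdd a) * v (Multiplicative.ofAdd b) := by
    rw [ofAdd_add, map_mul]
  have key : ∀ a b c d : dualMonoid τ, (a : Fin r → ℤ) - b = c - d →
      v (Multiplicative.ofAdd a) / v (Multiplicative.ofAdd b) =
        v (Multiplicative.ofAdd c) / v (Multiplicative.ofAdd d) := by
    intro a b c d h
    have h' : a + d = c + b := by
      ext1
      push_cast
      exact sub_eq_sub_iff_add_eq_add.mp h
    rw [div_eq_div_iff_mul_eq_mul, ← hv, ← hv, h']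
  choose a b hab using hρ
  refine ⟨MonoidHom.mk' (fun m => v (Multiplicative.ofAdd (a m.toAdd)) /
    v (Multiplicative.ofAdd (b m.toAdd))) fun m n => ?_, fun m c d h => ?_⟩
  · rw [div_mul_div_comm, ← hv, ← hv]
    apply key
    rw [← hab, toAdd_mul, map_add, hab, hab]
    push_cast
    abel
  · exact key _ _ _ _ ((hab m).symm.trans h)

variable {R : Type u} [CommRing R] [Algebra ℂ R]

/-- The semi-invariant `χ^m / χ^m (t)` as a polynomial. -/
def normalizedChi (proj : ToricRing τ →ₐ[ℂ] R) (t : Multiplicative (Fin r → ℤ) →* ℂˣ) :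
    Multiplicative (dualMonoid τ) →* R[X] where
  toFun m := Polynomial.C (proj (chi m.toAdd)) * algebraMap ℂ R[X] (charValue t m.toAdd)⁻¹
  map_one' := by simp [chi_zero, charValue_zero]
  map_mul' m n := by
    simp only [toAdd_mul, AddSubmonoid.coe_add, charValue_add, chi_add, map_mul, mul_inv]
    ring

variable {proj : ToricRing τ →ₐ[ℂ] R} {l : Fin r → ℤ}
  {t : Multiplicative (Fin r → ℤ) →* ℂˣ}

lemma mk_normalizedChi (m : dualMonoid τ) :
    Ideal.Quotient.mk (curveIdeal proj l t) (normalizedChi proj t (Multiplicative.ofAdd m)) =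
      CurveRing.s proj l t ^ (pairing l m).toNat := by
  change CurveRing.incl proj l t (proj (chi m)) *
    algebraMap ℂ (CurveRing proj l t) (charValue t m)⁻¹ = _
  rw [CurveRing.incl_chi, mul_right_comm, ← map_mul, mul_inv_cancel₀ (charValue_ne_zero _ _),
    map_one, one_mul]

variable [IsDomain R]

lemma normalizedChi_ne_zero (hproj : Function.Injective proj) (m : Multiplicative (dualMonoid τ)) :
    normalizedChi proj t m ≠ 0 := by
  refine mul_ne_zero ?_ ?_
  · rw [Polynomial.C_ne_zero, map_ne_zero_iff _ hproj]
    exact chi_ne_zero _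
  · rw [map_ne_zero_iff _ (algebraMap ℂ R[X]).injective]
    exact inv_ne_zero (charValue_ne_zero _ _)

/-- The denominator clearing used on a single semi-invariant monomial in `CurveRing.isDomain`. -/
lemma mul_mul_eq_mul_div_div {K : Type*} [Field K] {y p q : K} (hp : p ≠ 0) (hq : q ≠ 0)
    (hy : y ≠ 0) (x f g : K) : x * y * (f * g) = q * p * (f * (x / p / (q / y)) * g) := by
  field_simp

/-- The pullback of an equivariant flat morphism from a variety to the curve is a variety. -/
lemma CurveRing.isDomain (a : TorusAction (Fin r → ℤ) R)
    (ha : ∀ m : dualMonoid τ, a.HasWeight (m : Fin r → ℤ) (proj (chi m)))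
    (hflat : proj.toRingHom.Flat) (hproj : Function.Injective proj)
    (hl : ∀ m ∈ dualMonoid τ, 0 ≤ pairing l m) : IsDomain (CurveRing proj l t) := by
  let K := FractionRing R[X]
  let ι : R[X] →ₐ[ℂ] K := IsScalarTower.toAlgHom ℂ R[X] K
  have hι : Function.Injective ι := IsFractionRing.injective R[X] K
  let d (m : dualMonoid τ) : ℕ := (pairing l m).toNat
  have hd (m n) : d (m + n) = d m + d n := by
    simp only [d, AddSubmonoid.coe_add, map_add]
    exact Int.toNat_add (hl _ m.2) (hl _ n.2)
  let h (m : dualMonoid τ) : R[X] := normalizedChi proj t (Multiplicative.ofAdd m)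
  have hh (m n) : h (m + n) = h m * h n := by simp only [h, ofAdd_add, map_mul]
  have hh0 (m) : ι (h m) ≠ 0 :=
    (map_ne_zero_iff _ hι).mpr (normalizedChi_ne_zero hproj _)
  have hX : ι Polynomial.X ≠ 0 := (map_ne_zero_iff _ hι).mpr Polynomial.X_ne_zero
  -- The ratio of two `K`-points of `U_τ`: `l(X) • t`, and the image under `p` of the generic point
  -- of `𝒴`.
  let v : Multiplicative (dualMonoid τ) →* Kˣ :=
    { toFun m := Units.mk0 (ι Polynomial.X ^ d m.toAdd / ι (h m.toAdd))
        (div_ne_zero (pow_ne_zero _ hX) (hh0 _))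
      map_one' := by
        ext
        simp [d, h]
      map_mul' m n := by
        ext
        simp only [Units.val_mk0, Units.val_mul, toAdd_mul, hd, hh, map_mul, pow_add]
        rw [mul_div_mul_comm] }
  -- The cone may contain lines, so `S_τ` need not generate `M`; the retraction extends `v` to a
  -- character of all of `M`.
  obtain ⟨ρ, hρ, hρ'⟩ := exists_retraction_dualGroup τ
  obtain ⟨U, hU⟩ := exists_extend_dualMonoid v hρ
  -- Translating the generic point by `U` moves it into the fibre over `l(X) • t`. Together with `X`
  -- it is a `K`-point of the pullback.
  let θ : R →ₐ[ℂ] K := a.twist (ι.comp Polynomial.CAlgHom) ((Units.coeHom K).comp U)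
  have hθ {m f} (hf : a.HasWeight m f) : θ f =
      ι (Polynomial.C f) * (U (Multiplicative.ofAdd m) : Kˣ) :=
    TorusAction.twist_of_hasWeight _ _ hf
  let Θ : R[X] →ₐ[ℂ] K := Polynomial.aevalTower θ (ι Polynomial.X)
  have hΘC (f : R) : Θ (Polynomial.C f) = θ f := Polynomial.aevalTower_C _ _ _
  have hΘX : Θ Polynomial.X = ι Polynomial.X := Polynomial.aevalTower_X _ _
  have hle : curveIdeal proj l t ≤ RingHom.ker Θ := by
    rw [curveIdeal, Ideal.span_le]
    rintro _ ⟨m, rfl⟩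
    have h1 : (U (Multiplicative.ofAdd (m : Fin r → ℤ)) : K) =
        ι Polynomial.X ^ d m / ι (h m) := by
      rw [hU m m 0 (by simp [hρ']), ofAdd_zero, map_one, div_one]
      rfl
    have h2 : ι (Polynomial.C (proj (chi m))) = algebraMap ℂ K (charValue t m) * ι (h m) := by
      have : ι (h m) = ι (Polynomial.C (proj (chi m))) * algebraMap ℂ K (charValue t m)⁻¹ := by
        change ι (Polynomial.C (proj (chi m)) * algebraMap ℂ R[X] (charValue t m)⁻¹) = _
        rw [map_mul, AlgHom.commutes]
      rw [this, mul_left_comm, ← map_mul, mul_inv_cancel₀ (charValue_ne_zero _ _), map_one, mul_one]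
    simp only [SetLike.mem_coe, RingHom.mem_ker, map_sub, map_mul, map_pow, AlgHom.commutes]
    rw [hΘC, hΘX, hθ (ha m), h1, h2, mul_assoc, mul_div_cancel₀ _ (hh0 m), sub_self]
  -- Denominators of `Θ F` are cleared by some `X ^ N * h n`. On the pullback `h n` equals `s ^ d
  -- n`, and the cleared numerator `G` is `F` times a power of `s`.
  have key (F : R[X]) : ∃ (n : dualMonoid τ) (N : ℕ) (G : R[X]),
      ι G = ι (Polynomial.X ^ N * h n) * Θ F ∧ Ideal.Quotient.mk (curveIdeal proj l t) G =
        s proj l t ^ (N + d n) * Ideal.Quotient.mk (curveIdeal proj l t) F := by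
    have add (F₁ F₂ : R[X])
        (h₁ : ∃ (n : dualMonoid τ) (N : ℕ) (G : R[X]),
          ι G = ι (Polynomial.X ^ N * h n) * Θ F₁ ∧ Ideal.Quotient.mk (curveIdeal proj l t) G =
            s proj l t ^ (N + d n) * Ideal.Quotient.mk (curveIdeal proj l t) F₁)
        (h₂ : ∃ (n : dualMonoid τ) (N : ℕ) (G : R[X]),
          ι G = ι (Polynomial.X ^ N * h n) * Θ F₂ ∧ Ideal.Quotient.mk (curveIdeal proj l t) G =
            s proj l t ^ (N + d n) * Ideal.Quotient.mk (curveIdeal proj l t) F₂) :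
        ∃ (n : dualMonoid τ) (N : ℕ) (G : R[X]),
          ι G = ι (Polynomial.X ^ N * h n) * Θ (F₁ + F₂) ∧
          Ideal.Quotient.mk (curveIdeal proj l t) G =
            s proj l t ^ (N + d n) * Ideal.Quotient.mk (curveIdeal proj l t) (F₁ + F₂) := by
      obtain ⟨n₁, N₁, G₁, hG₁, hG₁'⟩ := h₁
      obtain ⟨n₂, N₂, G₂, hG₂, hG₂'⟩ := h₂
      refine ⟨n₁ + n₂, N₁ + N₂,
        Polynomial.X ^ N₂ * h n₂ * G₁ + Polynomial.X ^ N₁ * h n₁ * G₂, ?_, ?_⟩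
      · rw [map_add, map_mul, map_mul ι _ G₂, hG₁, hG₂, hh, map_add]
        simp only [map_mul, pow_add]
        ring
      · have hX' : Ideal.Quotient.mk (curveIdeal proj l t) Polynomial.X = s proj l t := rfl
        simp only [map_add, map_mul, map_pow, hG₁', hG₂', hd, h, mk_normalizedChi, hX']
        ring
    induction F using Polynomial.induction_on' with
    | add p q hp hq => exact add p q hp hq
    | monomial k f =>
      revert k
      induction f using a.induction_hasWeight with
      | zero => exact fun k => ⟨0, 0, 0, by simp, by simp⟩
      | add f g hf hg =>
        intro k
        rw [map_add]
        exact add _ _ (hf k) (hg k)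
      | weight m f hf =>
        intro k
        obtain ⟨b, c, hbc⟩ := hρ m
        -- Here `U` at `m` is `v b / v c`, with numerator `X ^ d b * h c` and denominator `X ^ d c *
        -- h b`; both restrict to `s ^ (d b + d c)`.
        refine ⟨b, d c, Polynomial.X ^ d b * h c * Polynomial.monomial k f, ?_, ?_⟩
        · rw [← Polynomial.C_mul_X_pow_eq_monomial, map_mul Θ, map_pow, hΘC, hΘX, hθ hf,
            hU m b c hbc]
          have h1 : ((v (Multiplicative.ofAdd b) / v (Multiplicative.ofAdd c) : Kˣ) : K) =
              (ι Polynomial.X ^ d b / ι (h b)) / (ι Polynomial.X ^ d c / ι (h c)) := by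
            rw [Units.val_div_eq_div_val]
            rfl
          rw [h1]
          simp only [map_mul, map_pow]
          exact mul_mul_eq_mul_div_div (hh0 b) (pow_ne_zero _ hX) (hh0 c) _ _ _
        · have hX' : Ideal.Quotient.mk (curveIdeal proj l t) Polynomial.X = s proj l t := rfl
          simp only [map_mul, map_pow, h, mk_normalizedChi, hX']
          ring
  -- If `Θ F = 0` then `G = 0`, so a power of `s` kills the class of `F`, which vanishes by
  -- flatness.
  have hker : curveIdeal proj l t = RingHom.ker Θ := by
    refine le_antisymm hle fun F hF => ?_
    obtain ⟨n, N, G, hG, hG'⟩ := key F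
    rw [RingHom.mem_ker] at hF
    rw [hF, mul_zero, map_eq_zero_iff _ hι] at hG
    rw [hG, map_zero] at hG'
    have hs (k : ℕ) (w : CurveRing proj l t) (hw : s proj l t ^ k * w = 0) : w = 0 := by
      induction k with
      | zero => simpa using hw
      | succ k ih => exact ih (eq_zero_of_s_mul hflat hl (by rw [← hw]; ring))
    exact Ideal.Quotient.eq_zero_iff_mem.mp (hs _ _ hG'.symm)
  have : (curveIdeal proj l t).IsPrime := by
    rw [hker]
    exact RingHom.ker_isPrime _
  exact Ideal.Quotient.isDomain _

end NegativeWeight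

/-! ### General fibres and the action on the pullback -/

namespace NegativeWeight

variable {r : ℕ} {τ : PointedCone ℝ (Fin r → ℝ)} {R : Type u} [CommRing R] [Algebra ℂ R]

namespace GeneralizedTestConfiguration

variable (D : GeneralizedTestConfiguration τ R) (l : Fin r → ℤ)
  (t : Multiplicative (Fin r → ℤ) →* ℂˣ)

/-- The comorphism of the closed immersion of the fibre over `t`. -/
def toFiber : R →ₐ[ℂ] D.Fiber t := Ideal.Quotient.mkₐ ℂ _

lemma toFiber_chi (m : dualMonoid τ) :
    D.toFiber t (D.proj (chi m)) = algebraMap ℂ _ (charValue t m) := by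
  have h : chi m - algebraMap ℂ _ (charValue t m) ∈ torusPointIdeal τ t :=
    Ideal.subset_span ⟨m, rfl⟩
  have h' := Ideal.Quotient.eq_zero_iff_mem.mpr (Ideal.mem_map_of_mem D.proj h)
  rw [map_sub, map_sub, sub_eq_zero, AlgHom.commutes] at h'
  exact h'

/-- The homomorphism out of the coordinate ring of the fibre over `t`. -/
def fiberLift {B : Type*} [CommRing B] [Algebra ℂ B] (φ : R →ₐ[ℂ] B)
    (h : ∀ m : dualMonoid τ, φ (D.proj (chi m)) = algebraMap ℂ B (charValue t m)) :
    D.Fiber t →ₐ[ℂ] B :=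
  Ideal.Quotient.liftₐ _ φ <| by
    intro g hg
    have : (torusPointIdeal τ t).map D.proj ≤ RingHom.ker φ := by
      rw [torusPointIdeal, Ideal.map_span, Ideal.span_le]
      rintro _ ⟨_, ⟨m, rfl⟩, rfl⟩
      simp only [SetLike.mem_coe, RingHom.mem_ker, map_sub, AlgHom.commutes, h]
      exact sub_self _
    exact this hg

@[simp] lemma fiberLift_toFiber {B : Type*} [CommRing B] [Algebra ℂ B] (φ : R →ₐ[ℂ] B)
    (h : ∀ m : dualMonoid τ, φ (D.proj (chi m)) = algebraMap ℂ B (charValue t m)) (f : R) :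
    D.fiberLift t φ h (D.toFiber t f) = φ f := rfl

lemma fiber_algHom_ext {B : Type*} [CommRing B] [Algebra ℂ B] {φ ψ : D.Fiber t →ₐ[ℂ] B}
    (h : φ.comp (D.toFiber t) = ψ.comp (D.toFiber t)) : φ = ψ :=
  Ideal.Quotient.algHom_ext _ h

lemma proj_injective : Function.Injective D.proj := D.faithfullyFlat.injective

variable {l} in
lemma curveRing_isDomain (hl : ∀ m ∈ dualMonoid τ, 0 ≤ pairing l m) :
    IsDomain (CurveRing D.proj l t) :=
  have := D.isDomain
  CurveRing.isDomain D.action D.equivariant D.faithfullyFlat.flat D.proj_injective hl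

/-- The fibres over the open orbit are varieties. -/
lemma fiber_isDomain : IsDomain (D.Fiber t) := by
  -- For the constant curve the fibre is a retract of the pullback: setting `s = 0` is a left
  -- inverse of the map `j`.
  have := D.curveRing_isDomain (l := 0) t fun m _ => by simp [pairing_apply]
  let j : D.Fiber t →ₐ[ℂ] CurveRing D.proj 0 t :=
    D.fiberLift t (CurveRing.incl D.proj 0 t) fun m => by
      rw [CurveRing.incl_chi]
      simp [pairing_apply]
  let q : CurveRing D.proj 0 t →ₐ[ℂ] D.Fiber t :=
    CurveRing.lift (D.toFiber t) 0 fun m => by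
      rw [D.toFiber_chi]
      simp [pairing_apply]
  have hqj : q.comp j = AlgHom.id ℂ _ := by
    refine D.fiber_algHom_ext t ?_
    ext f
    simp [q, j]
  have hj : Function.Injective j := by
    intro x y h
    have := congrArg q h
    simpa only [← AlgHom.comp_apply, hqj, AlgHom.id_apply] using this
  exact hj.isDomain j.toRingHom

section

variable {l} (hl : ∀ m ∈ dualMonoid τ, 0 ≤ pairing l m)

/-- The coaction on `R` that defines the one on the pullback to the curve. -/
def curveCoactAux (l : Fin r → ℤ) : R →ₐ[ℂ] AddMonoidAlgebra (CurveRing D.proj l t) ℤ :=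
  (AddMonoidAlgebra.mapAlgHom ℤ (CurveRing.incl D.proj l t)).comp
    (D.action.restrict (pairing l)).coact

lemma curveCoactAux_of_hasWeight {m : Fin r → ℤ} {f : R} (hf : D.action.HasWeight m f) :
    D.curveCoactAux t l f =
      AddMonoidAlgebra.single (pairing l m) (CurveRing.incl D.proj l t f) := by
  have h : (D.action.restrict (pairing l)).coact f = _ := hf.restrict (pairing l)
  rw [curveCoactAux, AlgHom.comp_apply, h, AddMonoidAlgebra.mapAlgHom_single]

lemma curveCoactAux_chi (hl : ∀ m ∈ dualMonoid τ, 0 ≤ pairing l m) (m : dualMonoid τ) :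
    D.curveCoactAux t l (D.proj (chi m)) =
    algebraMap ℂ (AddMonoidAlgebra (CurveRing D.proj l t) ℤ) (charValue t m) *
      (AddMonoidAlgebra.single (1 : ℤ) (CurveRing.s D.proj l t) :
        AddMonoidAlgebra (CurveRing D.proj l t) ℤ) ^ (pairing l m).toNat := by
  rw [D.curveCoactAux_of_hasWeight t (D.equivariant m), CurveRing.incl_chi,
    AddMonoidAlgebra.single_pow, nsmul_one, Int.natCast_toNat_eq_self.mpr (hl m m.2)]
  exact (congrArg _ (Algebra.smul_def _ _).symm).trans
    ((AddMonoidAlgebra.smul_single _ _ _).symm.trans (Algebra.smul_def _ _))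

/-- The coaction homomorphism of the pullback to the curve for which the coordinate of the curve
has weight one. -/
def curveCoact : CurveRing D.proj l t →ₐ[ℂ] AddMonoidAlgebra (CurveRing D.proj l t) ℤ :=
  CurveRing.lift (D.curveCoactAux t l) (AddMonoidAlgebra.single (1 : ℤ) (CurveRing.s D.proj l t))
    (D.curveCoactAux_chi t hl)

lemma curveCoact_s : D.curveCoact t hl (CurveRing.s D.proj l t) =
    AddMonoidAlgebra.single 1 (CurveRing.s D.proj l t) := by
  rw [curveCoact, CurveRing.lift_s]

lemma curveCoact_incl {m : Fin r → ℤ} {f : R} (hf : D.action.HasWeight m f) :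
    D.curveCoact t hl (CurveRing.incl D.proj l t f) =
      AddMonoidAlgebra.single (pairing l m) (CurveRing.incl D.proj l t f) := by
  rw [curveCoact, CurveRing.lift_incl, D.curveCoactAux_of_hasWeight t hf]

/-- The action on the pullback to the curve for which the coordinate of the curve has
weight one. -/
def curveAction : TorusAction ℤ (CurveRing D.proj l t) :=
  TorusAction.ofAdjoin (D.curveCoact t hl) <| by
    rw [eq_top_iff, ← CurveRing.adjoin_range_incl, Algebra.adjoin_le_iff, Set.union_subset_iff]
    refine ⟨?_, ?_⟩
    · rintro _ ⟨f, rfl⟩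
      induction f using D.action.induction_hasWeight with
      | zero => rw [map_zero]; exact zero_mem _
      | add f g hf hg => rw [map_add]; exact add_mem hf hg
      | weight m f hf => exact Algebra.subset_adjoin ⟨pairing l m, D.curveCoact_incl t hl hf⟩
    · rintro _ rfl
      exact Algebra.subset_adjoin ⟨1, D.curveCoact_s t hl⟩

lemma curveAction_isEffective : (D.curveAction t hl).IsEffective := by
  have := D.curveRing_isDomain t hl
  have hs : CurveRing.s D.proj l t ≠ 0 := fun h =>
    one_ne_zero (CurveRing.eq_zero_of_s_mul D.faithfullyFlat.flat hl (w := 1) (by rw [h, zero_mul]))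
  refine TorusAction.isEffective_of_hasWeight_one (fun z hz => ?_) (f := CurveRing.s D.proj l t)
    (D.curveCoact_s t hl)
  have h : (algebraMap ℂ (CurveRing D.proj l t) (z - 1)) * CurveRing.s D.proj l t = 0 := by
    rw [← Algebra.smul_def, sub_smul, hz, one_smul, sub_self]
  have h' := (mul_eq_zero.mp h).resolve_right hs
  rw [map_eq_zero_iff _ (algebraMap ℂ (CurveRing D.proj l t)).injective] at h'
  exact sub_eq_zero.mp h'

end

variable {l t}

/-- The character `m ↦ a ^ ⟨m, l⟩`. -/
def powChar (l : Fin r → ℤ) (B : Type*) [CommRing B] [Algebra ℂ B] (a : ℂˣ) :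
    Multiplicative (Fin r → ℤ) →* B where
  toFun m := algebraMap ℂ B ((a ^ pairing l m.toAdd : ℂˣ) : ℂ)
  map_one' := by simp
  map_mul' m n := by simp [zpow_add]

lemma powChar_mul_powChar_inv (B : Type*) [CommRing B] [Algebra ℂ B] (a : ℂˣ)
    (m : Multiplicative (Fin r → ℤ)) : powChar l B a m * powChar l B a⁻¹ m = 1 := by
  simp only [powChar, MonoidHom.coe_mk, OneHom.coe_mk, ← map_mul, ← Units.val_mul, inv_zpow,
    mul_inv_cancel, Units.val_one, map_one]

lemma powChar_toNat (hl : ∀ m ∈ dualMonoid τ, 0 ≤ pairing l m) (B : Type*) [CommRing B]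
    [Algebra ℂ B] (a : ℂˣ) (m : dualMonoid τ) :
    powChar l B a (Multiplicative.ofAdd (m : Fin r → ℤ)) =
      algebraMap ℂ B a ^ (pairing l m).toNat := by
  simp only [powChar, MonoidHom.coe_mk, OneHom.coe_mk, toAdd_ofAdd, ← map_pow]
  rw [← Units.val_pow_eq_pow_val, ← zpow_natCast, Int.natCast_toNat_eq_self.mpr (hl m m.2)]

lemma map_powChar {B B' : Type*} [CommRing B] [Algebra ℂ B] [CommRing B'] [Algebra ℂ B']
    (φ : B →ₐ[ℂ] B') (a : ℂˣ) (m : Multiplicative (Fin r → ℤ)) :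
    φ (powChar l B a m) = powChar l B' a m :=
  φ.commutes _

variable (t) in
/-- The comorphism of the embedding of the fibre over `t` into the pullback to the curve as the
fibre over `a`. -/
def curveToFiber (hl : ∀ m ∈ dualMonoid τ, 0 ≤ pairing l m) (a : ℂˣ) :
    CurveRing D.proj l t →ₐ[ℂ] D.Fiber t :=
  -- On closed points this is `x ↦ (l(a) • x, a)`, which carries the fibre over `t` to the fibre
  -- over `l(a) • t`.
  CurveRing.lift (D.action.twist (D.toFiber t) (powChar l _ a)) (algebraMap ℂ _ a) <| by
    intro m
    rw [TorusAction.twist_of_hasWeight _ _ (D.equivariant m), D.toFiber_chi, powChar_toNat hl]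

lemma curveToFiber_incl (hl : ∀ m ∈ dualMonoid τ, 0 ≤ pairing l m) (a : ℂˣ) {m : Fin r → ℤ}
    {f : R} (hf : D.action.HasWeight m f) :
    D.curveToFiber t hl a (CurveRing.incl D.proj l t f) =
      D.toFiber t f * powChar l _ a (Multiplicative.ofAdd m) := by
  rw [curveToFiber, CurveRing.lift_incl, TorusAction.twist_of_hasWeight _ _ hf]

lemma curveToFiber_s (hl : ∀ m ∈ dualMonoid τ, 0 ≤ pairing l m) (a : ℂˣ) :
    D.curveToFiber t hl a (CurveRing.s D.proj l t) = algebraMap ℂ _ a :=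
  CurveRing.lift_s

lemma curveToFiber_surjective (hl : ∀ m ∈ dualMonoid τ, 0 ≤ pairing l m) (a : ℂˣ) :
    Function.Surjective (D.curveToFiber t hl a) := by
  intro v
  obtain ⟨f, rfl⟩ : ∃ f, D.toFiber t f = v := Ideal.Quotient.mk_surjective v
  induction f using D.action.induction_hasWeight with
  | zero => exact ⟨0, by rw [map_zero, map_zero]⟩
  | add f g hf hg =>
    obtain ⟨x, hx⟩ := hf
    obtain ⟨y, hy⟩ := hg
    exact ⟨x + y, by rw [map_add, map_add, hx, hy]⟩
  | weight m f hf =>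
    refine ⟨CurveRing.incl D.proj l t f * powChar l _ a⁻¹ (Multiplicative.ofAdd m), ?_⟩
    rw [map_mul, D.curveToFiber_incl hl a hf, map_powChar, mul_assoc, powChar_mul_powChar_inv,
      mul_one]

/-- A homomorphism with value `a` at the coordinate factors through the fibre over `a`. -/
lemma exists_comp_curveToFiber (hl : ∀ m ∈ dualMonoid τ, 0 ≤ pairing l m) (a : ℂˣ)
    {Q : Type*} [CommRing Q] [Algebra ℂ Q] (π : CurveRing D.proj l t →ₐ[ℂ] Q)
    (hπ : π (CurveRing.s D.proj l t - algebraMap ℂ (CurveRing D.proj l t) a) = 0) :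
    ∃ G : D.Fiber t →ₐ[ℂ] Q, G.comp (D.curveToFiber t hl a) = π := by
  rw [map_sub, AlgHom.commutes, sub_eq_zero] at hπ
  -- Translation by `l(a⁻¹)` undoes the embedding.
  let ψ : R →ₐ[ℂ] Q :=
    D.action.twist (π.comp (CurveRing.incl D.proj l t)) (powChar l Q a⁻¹)
  have hψ (m : dualMonoid τ) : ψ (D.proj (chi m)) = algebraMap ℂ Q (charValue t m) := by
    rw [TorusAction.twist_of_hasWeight _ _ (D.equivariant m), AlgHom.comp_apply,
      CurveRing.incl_chi, map_mul, map_pow, hπ, AlgHom.commutes, ← powChar_toNat hl, mul_assoc,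
      powChar_mul_powChar_inv, mul_one]
  refine ⟨D.fiberLift t ψ hψ, CurveRing.algHom_ext
    (D.action.algHom_ext_of_hasWeight fun m f hf => ?_) ?_⟩
  · simp only [AlgHom.comp_apply]
    rw [D.curveToFiber_incl hl a hf, map_mul, map_powChar, fiberLift_toFiber,
      TorusAction.twist_of_hasWeight _ _ hf, AlgHom.comp_apply, mul_assoc,
      mul_comm (powChar l Q a⁻¹ _), powChar_mul_powChar_inv, mul_one]
  · rw [AlgHom.comp_apply, D.curveToFiber_s hl a, AlgHom.commutes, hπ]

lemma ker_curveToFiber_le (hl : ∀ m ∈ dualMonoid τ, 0 ≤ pairing l m) (a : ℂˣ)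
    {I : Ideal (CurveRing D.proj l t)}
    (hI : CurveRing.s D.proj l t - algebraMap ℂ (CurveRing D.proj l t) a ∈ I) :
    RingHom.ker (D.curveToFiber t hl a) ≤ I := by
  intro w hw
  let π : CurveRing D.proj l t →ₐ[ℂ] CurveRing D.proj l t ⧸ I := Ideal.Quotient.mkₐ ℂ I
  obtain ⟨G, hG⟩ := D.exists_comp_curveToFiber (t := t) (Q := CurveRing D.proj l t ⧸ I) hl a π
    (Ideal.Quotient.eq_zero_iff_mem.mpr hI)
  have h : G (D.curveToFiber t hl a w) = π w := AlgHom.congr_fun hG w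
  rw [RingHom.mem_ker.mp hw, map_zero] at h
  exact Ideal.Quotient.eq_zero_iff_mem.mp h.symm

lemma ker_curveToFiber (hl : ∀ m ∈ dualMonoid τ, 0 ≤ pairing l m) (a : ℂˣ) :
    RingHom.ker (D.curveToFiber t hl a) =
      Ideal.span {CurveRing.s D.proj l t - algebraMap ℂ (CurveRing D.proj l t) a} := by
  refine le_antisymm (D.ker_curveToFiber_le hl a (Ideal.mem_span_singleton_self _)) ?_
  rw [Ideal.span_le, Set.singleton_subset_iff, SetLike.mem_coe, RingHom.mem_ker, map_sub,
    AlgHom.commutes, D.curveToFiber_s, sub_self]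

/-- Away from zero, the fibres of the pullback to the curve are the fibre over `t`. -/
def curveFiberEquiv (hl : ∀ m ∈ dualMonoid τ, 0 ≤ pairing l m) (a : ℂˣ) :
    (CurveRing D.proj l t ⧸
      Ideal.span {CurveRing.s D.proj l t - algebraMap ℂ (CurveRing D.proj l t) a}) ≃ₐ[ℂ]
      D.Fiber t :=
  (Ideal.quotientEquivAlgOfEq ℂ (D.ker_curveToFiber hl a).symm).trans
    (Ideal.quotientKerAlgEquivOfSurjective (D.curveToFiber_surjective hl a))

end GeneralizedTestConfiguration

/-! ### The central fibre and its infinitesimal neighbourhoods -/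

namespace AlgebraicTestDeformation

variable {Y : Type u} [CommRing Y] [Algebra ℂ Y] {actY : TorusAction (Fin r → ℤ) Y}
  (D : AlgebraicTestDeformation τ actY R) {l : Fin r → ℤ}
  {t : Multiplicative (Fin r → ℤ) →* ℂˣ}

lemma restr_chi {m : dualMonoid τ} (hm : m ≠ 0) : D.restr (D.proj (chi m)) = 0 := by
  rw [← RingHom.mem_ker, D.ker_restr]
  exact Ideal.mem_map_of_mem _ (Ideal.subset_span ⟨m, hm, rfl⟩)

lemma hasWeight_restr {m : Fin r → ℤ} {f : R} (hf : D.action.HasWeight m f) :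
    actY.HasWeight m (D.restr f) := by
  have hf' : D.action.coact f = AddMonoidAlgebra.single m f := hf
  exact (D.restr_equivariant f).trans (by rw [hf', AddMonoidAlgebra.mapAlgHom_single])

/-- The ideal of `Y` in `𝒴` is generated by the `χ^m` with `m ≠ 0`, which pull back to multiples of
`s ^ ⟨m, l⟩`. The case `k = 1` identifies the central fibre; general `k` gives triviality modulo
`s^k`. -/
lemma incl_mem_span_s_pow {k : ℕ} (hl : ∀ m ∈ dualMonoid τ, m ≠ 0 → (k : ℤ) ≤ pairing l m)
    {f : R} (hf : D.restr f = 0) :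
    CurveRing.incl D.proj l t f ∈ Ideal.span {CurveRing.s D.proj l t ^ k} := by
  have h : (vertexIdeal τ).map D.proj ≤
      (Ideal.span {CurveRing.s D.proj l t ^ k}).comap (CurveRing.incl D.proj l t) := by
    rw [vertexIdeal, Ideal.map_span, Ideal.span_le]
    rintro _ ⟨_, ⟨m, hm, rfl⟩, rfl⟩
    rw [SetLike.mem_coe, Ideal.mem_comap, CurveRing.incl_chi]
    refine Ideal.mul_mem_left _ _ (Ideal.mem_span_singleton.mpr (pow_dvd_pow _ ?_))
    have := hl m m.2 (by simpa using hm)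
    omega
  rw [← RingHom.mem_ker, D.ker_restr] at hf
  exact h hf

/-- The comorphism of the closed immersion of `Y` into the pullback to the curve. -/
def curveRestr (hl : ∀ m ∈ dualMonoid τ, m ≠ 0 → 0 < pairing l m) :
    CurveRing D.proj l t →ₐ[ℂ] Y :=
  CurveRing.lift D.restr 0 <| by
    intro m
    by_cases hm : m = 0
    · subst hm
      simp [chi_zero, charValue_zero]
    · have := hl m m.2 (by simpa using hm)
      rw [D.restr_chi hm, zero_pow (by omega), mul_zero]

/-- Modulo `s` an element is the image of its constant coefficient; if that vanishes on `Y`, it is a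
multiple of `s`. -/
lemma ker_curveRestr (hl : ∀ m ∈ dualMonoid τ, m ≠ 0 → 0 < pairing l m) :
    RingHom.ker (D.curveRestr (t := t) hl) = Ideal.span {CurveRing.s D.proj l t} := by
  refine le_antisymm (fun w hw => ?_) ?_
  · obtain ⟨g, rfl⟩ := Ideal.Quotient.mk_surjective w
    have hg : Ideal.Quotient.mk (curveIdeal D.proj l t) g = CurveRing.s D.proj l t *
        Ideal.Quotient.mk _ g.divX + CurveRing.incl D.proj l t (g.coeff 0) := by
      conv_lhs => rw [← Polynomial.X_mul_divX_add g, map_add, map_mul]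
      rfl
    rw [hg] at hw ⊢
    rw [RingHom.mem_ker, map_add, map_mul, curveRestr, CurveRing.lift_s, zero_mul, zero_add,
      CurveRing.lift_incl] at hw
    refine add_mem (Ideal.mul_mem_right _ _ (Ideal.mem_span_singleton_self _)) ?_
    have := D.incl_mem_span_s_pow (l := l) (t := t) (k := 1) (fun m hm h => by
      have := hl m hm h; omega) hw
    rwa [pow_one] at this
  · rw [Ideal.span_le, Set.singleton_subset_iff, SetLike.mem_coe, RingHom.mem_ker, curveRestr,
      CurveRing.lift_s]

variable (t) in
/-- The pullback of an algebraic test deformation to the curve `s ↦ l (s) • t`. -/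
def curveDegeneration (hl : ∀ m ∈ dualMonoid τ, m ≠ 0 → 0 < pairing l m) :
    AffineDegeneration (D.Fiber t) Y (actY.restrict (pairing l)) (CurveRing D.proj l t) :=
  have hl' : ∀ m ∈ dualMonoid τ, 0 ≤ pairing l m := fun m hm => by
    by_cases h : m = 0
    · simp [h]
    · exact (hl m hm h).le
  { isDomain := D.curveRing_isDomain t hl'
    finiteType := by
      have := D.finiteType
      infer_instance
    p := CurveRing.s D.proj l t
    σ := D.curveAction t hl'
    effective := D.curveAction_isEffective t hl'
    μ := 1
    μ_pos := one_pos
    p_weight := D.curveCoact_s t hl'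
    restr := D.curveRestr hl
    restr_surjective := fun y => by
      obtain ⟨f, hf⟩ := D.restr_surjective y
      exact ⟨CurveRing.incl D.proj l t f, (CurveRing.lift_incl f).trans hf⟩
    ker_restr := D.ker_curveRestr hl
    restr_equivariant := by
      have h : (actY.restrict (pairing l)).coact.comp (D.curveRestr hl) =
          (AddMonoidAlgebra.mapAlgHom ℤ (D.curveRestr hl)).comp (D.curveAction t hl').coact := by
        refine CurveRing.algHom_ext (D.action.algHom_ext_of_hasWeight fun m f hf => ?_) ?_
        · have h1 : (D.curveAction t hl').coact _ = _ := D.curveCoact_incl t hl' hf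
          have h2 : (actY.restrict (pairing l)).coact _ = _ :=
            (D.hasWeight_restr hf).restrict (pairing l)
          simp only [AlgHom.comp_apply]
          rw [h1, AddMonoidAlgebra.mapAlgHom_single, curveRestr, CurveRing.lift_incl, h2]
        · have h1 : (D.curveAction t hl').coact _ = _ := D.curveCoact_s t hl'
          simp only [AlgHom.comp_apply]
          rw [h1, AddMonoidAlgebra.mapAlgHom_single, curveRestr, CurveRing.lift_s, map_zero,
            AddMonoidAlgebra.single_zero]
      exact fun f => AlgHom.congr_fun h f
    fiber_iso := fun a ha => ⟨D.curveFiberEquiv hl' (Units.mk0 a ha)⟩ }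

/-- Modulo `s^k` all `χ^m` with `m ≠ 0` vanish, so the relations of the pullback reduce to those
defining `Y`, and applying `restr` to coefficients is the trivialization. -/
lemma curveDegeneration_isTrivialModulo (hl : ∀ m ∈ dualMonoid τ, m ≠ 0 → 0 < pairing l m)
    {k : ℕ} (hk : 1 ≤ k) (hlk : ∀ m ∈ dualMonoid τ, m ≠ 0 → (k : ℤ) ≤ pairing l m) :
    (D.curveDegeneration t hl).IsTrivialModulo k := by
  let P := Y[X] ⧸ Ideal.span {(Polynomial.X : Y[X]) ^ k}
  let π : Y[X] →ₐ[ℂ] P := Ideal.Quotient.mkₐ ℂ _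
  have hπX {n : ℕ} (hn : k ≤ n) : π Polynomial.X ^ n = 0 := by
    rw [← map_pow]
    exact Ideal.Quotient.eq_zero_iff_mem.mpr (Ideal.mem_span_singleton.mpr (pow_dvd_pow _ hn))
  let F : CurveRing D.proj l t →ₐ[ℂ] P :=
    CurveRing.lift (π.comp (Polynomial.CAlgHom.comp D.restr)) (π Polynomial.X) <| by
      intro m
      by_cases hm : m = 0
      · subst hm
        simp [chi_zero, charValue_zero]
      · have := hlk m m.2 (by simpa using hm)
        rw [AlgHom.comp_apply, AlgHom.comp_apply, D.restr_chi hm, map_zero, map_zero,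
          hπX (by omega), mul_zero]
  have hFs : F (CurveRing.s D.proj l t) = π Polynomial.X := CurveRing.lift_s
  have hF (g : R[X]) : F (Ideal.Quotient.mk _ g) = π (g.map D.restr.toRingHom) := by
    have : F.comp (Ideal.Quotient.mkₐ ℂ _) = π.comp (Polynomial.mapAlgHom D.restr) := by
      refine Polynomial.algHom_ext' ?_ ?_
      · ext f
        change F (CurveRing.incl D.proj l t f) = _
        rw [CurveRing.lift_incl]
        simp
      · change F (CurveRing.s D.proj l t) = _
        rw [hFs]
        simp
    exact AlgHom.congr_fun this g
  have hF0 : ∀ w ∈ Ideal.span {CurveRing.s D.proj l t ^ k}, F w = 0 := by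
    have : Ideal.span {CurveRing.s D.proj l t ^ k} ≤ RingHom.ker F := by
      rw [Ideal.span_le, Set.singleton_subset_iff, SetLike.mem_coe, RingHom.mem_ker, map_pow,
        CurveRing.lift_s, hπX le_rfl]
    exact fun w hw => this hw
  let E : (CurveRing D.proj l t ⧸ Ideal.span {CurveRing.s D.proj l t ^ k}) →ₐ[ℂ] P :=
    Ideal.Quotient.liftₐ _ F hF0
  have hE (w) : E (Ideal.Quotient.mk _ w) = F w := rfl
  have hdvd {f g : Y[X]} : π f = π g ↔ Polynomial.X ^ k ∣ f - g := by
    rw [← Ideal.mem_span_singleton]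
    exact Ideal.Quotient.eq
  have hbij : Function.Bijective E := by
    constructor
    · rw [injective_iff_map_eq_zero]
      intro w hw
      obtain ⟨w, rfl⟩ := Ideal.Quotient.mk_surjective w
      obtain ⟨g, rfl⟩ := Ideal.Quotient.mk_surjective w
      rw [hE, hF, ← map_zero π, hdvd, sub_zero, Polynomial.X_pow_dvd_iff] at hw
      rw [Ideal.Quotient.eq_zero_iff_mem, g.as_sum_range_C_mul_X_pow, map_sum]
      refine Ideal.sum_mem _ fun i _ => ?_
      rw [map_mul, map_pow]
      rcases lt_or_ge i k with hi | hi
      -- A coefficient in degree below `k` restricts to zero on `Y`, so it is already divisible by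
      -- `s^k`.
      · refine Ideal.mul_mem_right _ _ (D.incl_mem_span_s_pow hlk ?_)
        have := hw i hi
        rwa [Polynomial.coeff_map] at this
      · exact Ideal.mul_mem_left _ _ (Ideal.mem_span_singleton.mpr (pow_dvd_pow _ hi))
    · intro y
      obtain ⟨f, rfl⟩ := Ideal.Quotient.mk_surjective y
      obtain ⟨g, rfl⟩ := Polynomial.map_surjective D.restr.toRingHom D.restr_surjective f
      exact ⟨Ideal.Quotient.mk _ (Ideal.Quotient.mk _ g), hF g⟩
  refine ⟨AlgEquiv.ofBijective E hbij, hFs, fun w f h => ?_⟩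
  obtain ⟨g, rfl⟩ := Ideal.Quotient.mk_surjective w
  have h1 : π (g.map D.restr.toRingHom) = π f := (hF g).symm.trans h
  -- As `k ≥ 1`, congruence modulo `X^k` determines the constant coefficient, that is, the
  -- restriction to the central fibre.
  have h2 : (g.map D.restr.toRingHom).coeff 0 = f.coeff 0 := by
    rw [hdvd, Polynomial.X_pow_dvd_iff] at h1
    have := h1 0 (by omega)
    rwa [Polynomial.coeff_sub, sub_eq_zero] at this
  rw [← h2, Polynomial.coeff_map]
  change _ = Polynomial.aevalTower D.restr 0 g
  conv_rhs => rw [← Polynomial.X_mul_divX_add g, map_add, map_mul, Polynomial.aevalTower_X,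
    zero_mul, zero_add, Polynomial.aevalTower_C]
  rfl

end AlgebraicTestDeformation

end NegativeWeight

end

/-! ### The approximating degenerations and the weight bound -/

theorem mainTheorem12 {r : ℕ} (τ : PointedCone ℝ (Fin r → ℝ)) (ξ : Fin r → ℝ) (hξ0 : ξ ≠ 0)
    (hξ : ξ ∈ interior (τ : Set (Fin r → ℝ)))
    (Y : Type u) [CommRing Y] [IsDomain Y] [Algebra ℂ Y] [Algebra.FiniteType ℂ Y]
    (actY : NegativeWeight.TorusAction (Fin r → ℤ) Y)
    (R : Type u) [CommRing R] [Algebra ℂ R]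
    (D : NegativeWeight.AlgebraicNegativeWeightDeformation τ actY ξ R)
    (t : Multiplicative (Fin r → ℤ) →* ℂˣ) :
    NegativeWeight.IsNegativeWeightDeformation actY ξ (D.Fiber t) := by
  open NegativeWeight in
  obtain ⟨ε, hε, hbound⟩ := exists_le_realPairing hξ
  -- The bound `ε` keeps `ξ_i` where the pairings are uniformly positive; `1 / (i + 1)` forces
  -- convergence.
  have happrox (i : ℕ) := exists_primitive_near hξ0 (η := min ε (1 / ((i : ℝ) + 1)))
    (lt_min hε Nat.one_div_pos_of_nat)
  choose ξs c l hdist hc hcl hsurj using happrox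
  refine ⟨D.fiber_isDomain t, ?_, ξs, c, l, ?_, hc, hcl, fun i => D.good.1.restrict (hsurj i),
    ε, hε, fun i => ?_⟩
  · have := D.finiteType
    infer_instance
  · rw [tendsto_iff_dist_tendsto_zero]
    exact squeeze_zero (fun _ => dist_nonneg)
      (fun i => ((hdist i).trans_le (min_le_right _ _)).le)
      tendsto_one_div_add_atTop_nhds_zero_nat
  -- The integer `⟨m, l_i⟩ = c_i ⟨m, ξ_i⟩` is at least `c_i ε`, hence at least its ceiling; and `k /
  -- c_i ≥ ε`.
  · let k : ℕ := ⌈c i * ε⌉₊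
    have hk : 1 ≤ k := Nat.one_le_ceil_iff.mpr (mul_pos (hc i) hε)
    have hlk : ∀ m ∈ dualMonoid τ, m ≠ 0 → (k : ℤ) ≤ pairing (l i) m := by
      intro m hm hm0
      have h1 : ((pairing (l i) m : ℤ) : ℝ) = c i * realPairing m (ξs i) := by
        rw [pairing_apply, realPairing, Finset.mul_sum]
        push_cast
        exact Finset.sum_congr rfl fun j _ => by rw [← hcl]; ring
      have h2 : c i * ε ≤ ((pairing (l i) m : ℤ) : ℝ) := by
        rw [h1]
        exact mul_le_mul_of_nonneg_left
          (hbound _ ((hdist i).trans_le (min_le_left _ _)) m hm hm0) (hc i).le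
      rw [Int.natCast_ceil_eq_ceil (mul_pos (hc i) hε).le]
      exact Int.ceil_le.mpr h2
    have hl : ∀ m ∈ dualMonoid τ, m ≠ 0 → 0 < pairing (l i) m := fun m hm hm0 => by
      have := hlk m hm hm0
      omega
    refine ⟨_, _, _, D.curveDegeneration t hl, ?_⟩
    have hv : (k : ℕ∞) ≤ (D.curveDegeneration t hl).vanishingOrder :=
      le_iSup₂_of_le k ⟨hk, D.curveDegeneration_isTrivialModulo hl hk hlk⟩ le_rfl
    have hμ : (D.curveDegeneration t hl).μ = 1 := rfl
    rw [hμ, Nat.cast_one, mul_one,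
      ENNReal.le_div_iff_mul_le (Or.inl (by simpa using hc i)) (Or.inl ENNReal.ofReal_ne_top),
      ← ENNReal.ofReal_mul hε.le, mul_comm]
    calc ENNReal.ofReal (c i * ε) ≤ ENNReal.ofReal (k : ℝ) :=
          ENNReal.ofReal_le_ofReal (Nat.le_ceil _)
      _ = ((k : ℕ∞) : ℝ≥0∞) := by simp
      _ ≤ _ := ENat.toENNReal_le.mpr hv
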